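/- A partite $3$-uniform hypergraph $H=(A,B,C,E)$ has pairwise disjoint finite vertex classes $A=\{a_1,\dots,a_{n_1}\}$, $B=\{b_1,\dots,b_{n_2}\}$, $C=\{c_1,\dots,c_{n_3}\}$ and a set of hyperedges $E\subseteq A\times B\times C$; the degree of a vertex is the number of hyperedges incident with it. A degree sequence is a triple $D=\big((d_{1,1},\dots,d_{1,n_1}),(d_{2,1},\dots,d_{2,n_2}),(d_{3,1},\dots,d_{3,n_3})\big)$ of sequences of non-negative integers. A realization of $D$ is a partite $3$-uniform hypergraph with vertex classes of sizes $n_1,n_2,n_3$ in which $a_i$, $b_i$, $c_i$ have degrees $d_{1,i}$, $d_{2,i}$, $d_{3,i}$ for all $i$; $D$ is graphic if it has a realization. $D$ is third almost-regular if for some $k$ we have $d_{1,i}\in\{k,k-1\}$ for all $i=1,\dots,n_1$; nothing is assumed about the other two classes. **Theorem.** There is a polynomial-time algorithm that, given a third almost-regular degree sequence $D$, decides whether $D$ is graphic and, if it is, also constructs a realization of $D$ (as a list of its hyperedges). That is, there are a single program and a single polynomial $p$ such that on every third almost-regular $D$ (for all $n_1,n_2,n_3$ and all $k$) the program halts with the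 correct output in time at most $p(N)$, where $N$ is the length of $D$ written in binary. Time is measured on a random access machine with addition, subtraction and indirect addressing under the logarithmic cost criterion, where every operation costs one unit plus the number of binary digits of the numbers and addresses that it handles. -/

import Mathlib

/-! ## Partite 3-uniform hypergraphs and their degree sequences -/

/-- A sequence `(d_{1,1},…,d_{1,n₁}), (d_{2,1},…,d_{2,n₂}), (d_{3,1},…,d_{3,n₃})` of non-negative
integers, broken down by the three vertex classes `A = Fin n₁`, `B = Fin n₂`, `C = Fin n₃`. -/
structure DegreeSequence (n₁ n₂ n₃ : ℕ) where
  dA : Fin n₁ → ℕ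
  dB : Fin n₂ → ℕ
  dC : Fin n₃ → ℕ

/-- A partite 3-uniform hypergraph on the vertex classes `Fin n₁`, `Fin n₂`, `Fin n₃`, given by its
set of hyperedges; a hyperedge has exactly one vertex in each class. -/
abbrev PartiteHypergraph (n₁ n₂ n₃ : ℕ) : Type := Finset (Fin n₁ × Fin n₂ × Fin n₃)

namespace PartiteHypergraph

variable {n₁ n₂ n₃ : ℕ}

/-- The degree of a vertex of the first class: the number of hyperedges incident with it. -/
def degA (H : PartiteHypergraph n₁ n₂ n₃) (a : Fin n₁) : ℕ := (H.filter fun e => e.1 = a).card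

/-- The degree of a vertex of the second class. -/
def degB (H : PartiteHypergraph n₁ n₂ n₃) (b : Fin n₂) : ℕ := (H.filter fun e => e.2.1 = b).card

/-- The degree of a vertex of the third class. -/
def degC (H : PartiteHypergraph n₁ n₂ n₃) (c : Fin n₃) : ℕ := (H.filter fun e => e.2.2 = c).card

/-- `H` is a realization of `D`: the degrees of the vertices of `H` are the entries of `D`. -/
def IsRealization (H : PartiteHypergraph n₁ n₂ n₃) (D : DegreeSequence n₁ n₂ n₃) : Prop :=
  (∀ a, H.degA a = D.dA a) ∧ (∀ b, H.degB b = D.dB b) ∧ (∀ c, H.degC c = D.dC c)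

end PartiteHypergraph

namespace DegreeSequence

variable {n₁ n₂ n₃ : ℕ}

/-- `D` is graphic if it has a realization. -/
def Graphic (D : DegreeSequence n₁ n₂ n₃) : Prop :=
  ∃ H : PartiteHypergraph n₁ n₂ n₃, H.IsRealization D

/-- `D` is third almost-regular: for some `k`, every degree in the first class is `k` or `k - 1`
(the latter is written `d + 1 = k`, so that no truncated subtraction occurs). -/
def ThirdAlmostRegular (D : DegreeSequence n₁ n₂ n₃) : Prop :=
  ∃ k : ℕ, ∀ i, D.dA i = k ∨ D.dA i + 1 = k

/-- The length of `D` written in binary: `Nat.size d` is the number of binary digits of `d`, and one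
further symbol per entry is counted as a separator. -/
def bitLength (D : DegreeSequence n₁ n₂ n₃) : ℕ :=
  (∑ i, (Nat.size (D.dA i) + 1)) + (∑ j, (Nat.size (D.dB j) + 1))
    + ∑ k, (Nat.size (D.dC k) + 1)

end DegreeSequence

/-! ## Random access machine programs with logarithmic (bit) cost -/

namespace RAM

/-- The memory of the machine: registers `reg 0, reg 1, …` and arrays `arr 0, arr 1, …`, all holding
natural numbers. A program mentions finitely many registers and arrays by fixed indices; the cells
of an array are addressed by the contents of registers. -/
structure State where
  reg : ℕ → ℕ
  arr : ℕ → ℕ → ℕ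

/-- Overwrite one register. -/
def State.setReg (s : State) (x v : ℕ) : State :=
  { s with reg := Function.update s.reg x v }

/-- Overwrite one cell of an array. -/
def State.setArr (s : State) (a i v : ℕ) : State :=
  { s with arr := Function.update s.arr a (Function.update (s.arr a) i v) }

/-- Programs of the machine. The only arithmetic is addition and truncated subtraction. -/
inductive Prog where
  /-- do nothing -/
  | skip
  /-- `x := c` for a fixed number `c` -/
  | const (x c : ℕ)
  /-- `x := y + z` -/
  | add (x y z : ℕ)
  /-- `x := y - z`, truncated at zero -/
  | sub (x y z : ℕ)
  /-- `x := a[i]` -/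
  | load (x a i : ℕ)
  /-- `a[i] := x` -/
  | store (a i x : ℕ)
  /-- `P; Q` -/
  | seq (P Q : Prog)
  /-- `if x ≠ 0 then P else Q` -/
  | cond (x : ℕ) (P Q : Prog)
  /-- `while x ≠ 0 do P` -/
  | loop (x : ℕ) (P : Prog)

/-- `Exec P s t s'`: started in the memory `s`, the program `P` halts in the memory `s'` after
running for time `t`. Every elementary operation and every test costs one unit plus the number of
binary digits of all the numbers that it handles, array addresses included. -/
inductive Exec : Prog → State → ℕ → State → Prop where
  | skip (s : State) : Exec .skip s 1 s
  | const (x c : ℕ) (s : State) :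
      Exec (.const x c) s (1 + Nat.size c) (s.setReg x c)
  | add (x y z : ℕ) (s : State) :
      Exec (.add x y z) s (1 + Nat.size (s.reg y) + Nat.size (s.reg z))
        (s.setReg x (s.reg y + s.reg z))
  | sub (x y z : ℕ) (s : State) :
      Exec (.sub x y z) s (1 + Nat.size (s.reg y) + Nat.size (s.reg z))
        (s.setReg x (s.reg y - s.reg z))
  | load (x a i : ℕ) (s : State) :
      Exec (.load x a i) s (1 + Nat.size (s.reg i) + Nat.size (s.arr a (s.reg i)))
        (s.setReg x (s.arr a (s.reg i)))
  | store (a i x : ℕ) (s : State) :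
      Exec (.store a i x) s (1 + Nat.size (s.reg i) + Nat.size (s.reg x))
        (s.setArr a (s.reg i) (s.reg x))
  | seq {P Q : Prog} {s s' s'' : State} {t t' : ℕ} :
      Exec P s t s' → Exec Q s' t' s'' → Exec (.seq P Q) s (t + t') s''
  | condTrue {x : ℕ} {P Q : Prog} {s s' : State} {t : ℕ} :
      s.reg x ≠ 0 → Exec P s t s' → Exec (.cond x P Q) s (1 + Nat.size (s.reg x) + t) s'
  | condFalse {x : ℕ} {P Q : Prog} {s s' : State} {t : ℕ} :
      s.reg x = 0 → Exec Q s t s' → Exec (.cond x P Q) s (1 + Nat.size (s.reg x) + t) s'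
  | loopStep {x : ℕ} {P : Prog} {s s' s'' : State} {t t' : ℕ} :
      s.reg x ≠ 0 → Exec P s t s' → Exec (.loop x P) s' t' s'' →
        Exec (.loop x P) s (1 + Nat.size (s.reg x) + t + t') s''
  | loopDone {x : ℕ} {P : Prog} {s : State} :
      s.reg x = 0 → Exec (.loop x P) s (1 + Nat.size (s.reg x)) s

/-- The machine is deterministic: a program has at most one halting run from a given memory, so the
final memory and the running time are functions of the initial memory. -/
theorem Exec.deterministic {P : Prog} {s s₁ s₂ : State} {t₁ t₂ : ℕ}
    (h₁ : Exec P s t₁ s₁) (h₂ : Exec P s t₂ s₂) : t₁ = t₂ ∧ s₁ = s₂ := by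
  induction h₁ generalizing t₂ s₂ with
  | skip | const | add | sub | load | store => cases h₂; exact ⟨rfl, rfl⟩
  | seq _ _ ih ih' =>
    cases h₂ with
    | seq k k' =>
      obtain ⟨rfl, rfl⟩ := ih k
      obtain ⟨rfl, rfl⟩ := ih' k'
      exact ⟨rfl, rfl⟩
  | condTrue hx _ ih =>
    cases h₂ with
    | condTrue _ k => obtain ⟨rfl, rfl⟩ := ih k; exact ⟨rfl, rfl⟩
    | condFalse hx' _ => exact absurd hx' hx
  | condFalse hx _ ih =>
    cases h₂ with
    | condTrue hx' _ => exact absurd hx hx'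
    | condFalse _ k => obtain ⟨rfl, rfl⟩ := ih k; exact ⟨rfl, rfl⟩
  | loopStep hx _ _ ih ih' =>
    cases h₂ with
    | loopStep _ k k' =>
      obtain ⟨rfl, rfl⟩ := ih k
      obtain ⟨rfl, rfl⟩ := ih' k'
      exact ⟨rfl, rfl⟩
    | loopDone hx' => exact absurd hx' hx
  | loopDone hx =>
    cases h₂ with
    | loopStep hx' _ _ => exact absurd hx hx'
    | loopDone _ => exact ⟨rfl, rfl⟩

variable {n₁ n₂ n₃ : ℕ}

/-- The initial memory on input `D`: registers `0, 1, 2` hold the lengths `n₁, n₂, n₃`, arrays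
`0, 1, 2` hold the three sequences of degrees, and everything else is zero. -/
def input (D : DegreeSequence n₁ n₂ n₃) : State where
  reg x := if x = 0 then n₁ else if x = 1 then n₂ else if x = 2 then n₃ else 0
  arr a i :=
    if a = 0 then (if h : i < n₁ then D.dA ⟨i, h⟩ else 0)
    else if a = 1 then (if h : i < n₂ then D.dB ⟨i, h⟩ else 0)
    else if a = 2 then (if h : i < n₃ then D.dC ⟨i, h⟩ else 0)
    else 0

/-- The answer yes (register `3` is `1`). -/
def State.Accepts (s : State) : Prop := s.reg 3 = 1

/-- The answer no (register `3` is `0`). -/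
def State.Rejects (s : State) : Prop := s.reg 3 = 0

/-- The list of triples written as output: register `4` holds its length, and the triple number `e`
is `(arr 3 e, arr 4 e, arr 5 e)`. -/
def State.edgeList (s : State) : List (ℕ × ℕ × ℕ) :=
  (List.range (s.reg 4)).map fun e => (s.arr 3 e, s.arr 4 e, s.arr 5 e)

/-- The output is a list of all the hyperedges of `H`, each of them listed exactly once. -/
def State.Outputs (s : State) (H : PartiteHypergraph n₁ n₂ n₃) : Prop :=
  s.edgeList.Nodup ∧
    ∀ x y z : ℕ, (x, y, z) ∈ s.edgeList ↔
      ∃ (hx : x < n₁) (hy : y < n₂) (hz : z < n₃),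
        ((⟨x, hx⟩, ⟨y, hy⟩, ⟨z, hz⟩) : Fin n₁ × Fin n₂ × Fin n₃) ∈ H

end RAM

namespace RAM

/-! ## Step counting for machine programs -/

namespace State

/-! Let `m b c` be the number of hyperedges through the pair `(b, c)`. In a realization, `m` is an
`n₂ × n₃` matrix with entries at most `n₁`, row sums `dB` and column sums `dC`. Conversely, take any
such matrix and read its entries as the row sums of a 0-1 matrix with `n₂ * n₃` rows and `n₁`
columns whose column sums are `dA`; a solution of this second problem is exactly a realization with
pair counts `m`. Because `dA` is almost constant, the second problem is solvable as soon as the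
totals agree (`exists_isTransport_of_almostRegular`): units can be moved within rows from overfull
to deficient columns. So `D` is graphic iff the first matrix exists and `dA`, `dB` have equal
totals, and it does not matter which first matrix is found.

Both problems ask for a matrix with bounded entries and given row and column sums. One greedy
procedure solves them: fill the rows in turn, putting each unit into a column that has room in this
row and the largest missing sum. The exchange argument `IsTransport.exists_place` shows that such a
choice preserves completability, and `GreedyInv` carries this through the run.

For the running time, degrees may be exponentially large in the input length, so loops must not be
bounded by them. A row with `C` cells of capacity `q` absorbs at most `C * q` units before it is
full or given up, which makes the number of steps polynomial in `n₁, n₂, n₃`. Numbers grow by at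
most one digit per step, so `K` steps on numbers of `w` digits cost at most `K * (2 * (w + K) + 1)`.
-/

@[simp] theorem reg_setReg_same (s : State) (x v : ℕ) : (s.setReg x v).reg x = v := by
  simp [setReg]

@[simp] theorem reg_setReg_ne (s : State) {x y : ℕ} (v : ℕ) (h : y ≠ x) :
    (s.setReg x v).reg y = s.reg y := by
  simp [setReg, h]

@[simp] theorem arr_setReg (s : State) (x v : ℕ) : (s.setReg x v).arr = s.arr := rfl

@[simp] theorem reg_setArr (s : State) (a i v : ℕ) : (s.setArr a i v).reg = s.reg := rfl

@[simp] theorem arr_setArr_same (s : State) (a i v : ℕ) :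
    (s.setArr a i v).arr a = Function.update (s.arr a) i v := by
  simp [setArr]

@[simp] theorem arr_setArr_ne (s : State) {a b : ℕ} (i v : ℕ) (h : b ≠ a) :
    (s.setArr a i v).arr b = s.arr b := by
  simp [setArr, h]

/-- All numbers in the memory have at most `w` binary digits. -/
def SizeLE (s : State) (w : ℕ) : Prop :=
  (∀ x, Nat.size (s.reg x) ≤ w) ∧ ∀ a i, Nat.size (s.arr a i) ≤ w

theorem SizeLE.mono {s : State} {w w' : ℕ} (h : s.SizeLE w) (hw : w ≤ w') : s.SizeLE w' :=
  ⟨fun x => (h.1 x).trans hw, fun a i => (h.2 a i).trans hw⟩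

theorem SizeLE.setReg {s : State} {w v : ℕ} (h : s.SizeLE w) (x : ℕ) (hv : Nat.size v ≤ w) :
    (s.setReg x v).SizeLE w := by
  refine ⟨fun y => ?_, h.2⟩
  by_cases hy : y = x
  · subst hy; simpa using hv
  · rw [reg_setReg_ne _ _ hy]; exact h.1 y

theorem SizeLE.setArr {s : State} {w v : ℕ} (h : s.SizeLE w) (a i : ℕ) (hv : Nat.size v ≤ w) :
    (s.setArr a i v).SizeLE w := by
  refine ⟨h.1, fun b j => ?_⟩
  by_cases hb : b = a
  · subst hb
    by_cases hj : j = i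
    · subst hj; simpa using hv
    · simpa [hj] using h.2 b j
  · rw [arr_setArr_ne _ _ _ hb]; exact h.2 b j

end State

theorem size_add_le {a b w : ℕ} (ha : Nat.size a ≤ w) (hb : Nat.size b ≤ w) :
    Nat.size (a + b) ≤ w + 1 := by
  rw [Nat.size_le] at *
  rw [pow_succ]; omega

/-- Started in `s`, the program `P` halts after at most `K` steps in a memory satisfying `Q`.
Since a step makes the numbers in the memory longer by at most one digit, the number of steps
controls the logarithmic cost, and this is how the bound on the steps is expressed. -/
def Runs (P : Prog) (s : State) (K : ℕ) (Q : State → Prop) : Prop :=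
  ∀ w, s.SizeLE w → ∃ t s', Exec P s t s' ∧ t ≤ K * (2 * (w + K) + 1) ∧ s'.SizeLE (w + K) ∧ Q s'

namespace Runs

variable {P : Prog} {s : State} {K K' : ℕ} {Q Q' : State → Prop}

theorem mono (h : Runs P s K Q) (hK : K ≤ K') (hQ : ∀ s', Q s' → Q' s') : Runs P s K' Q' := by
  intro w hw
  obtain ⟨t, s', he, ht, hb, hq⟩ := h w hw
  refine ⟨t, s', he, ht.trans ?_, hb.mono (by omega), hQ _ hq⟩
  gcongr

theorem of_le (hK : K ≤ K') (h : Runs P s K Q) : Runs P s K' Q := h.mono hK fun _ h => h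

/-- The budget is `K + 1` instead of `1` so that the end of a block absorbs whatever is left;
branches of different length can then share one bound. -/
theorem skip (h : Q s) : Runs .skip s (K + 1) Q := fun w hw =>
  ⟨_, _, .skip s, by nlinarith [Nat.zero_le (K * (w + (K + 1)))], hw.mono (by omega), h⟩

/-- Restricting constants to `0` and `1` keeps the growth at one digit per step. -/
theorem const {x c : ℕ} (hc : c ≤ 1) (h : Q (s.setReg x c)) : Runs (.const x c) s 1 Q := by
  intro w hw
  have hs : Nat.size c ≤ 1 := by rw [Nat.size_le]; omega
  exact ⟨_, _, .const x c s, by omega, (hw.mono (by omega)).setReg _ (by omega), h⟩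

theorem add {x y z : ℕ} (h : Q (s.setReg x (s.reg y + s.reg z))) : Runs (.add x y z) s 1 Q := by
  intro w hw
  have h1 := hw.1 y
  have h2 := hw.1 z
  exact ⟨_, _, .add x y z s, by omega, (hw.mono (by omega)).setReg _ (size_add_le h1 h2), h⟩

theorem sub {x y z : ℕ} (h : Q (s.setReg x (s.reg y - s.reg z))) : Runs (.sub x y z) s 1 Q := by
  intro w hw
  have h1 := hw.1 y
  have h2 := hw.1 z
  have h3 : Nat.size (s.reg y - s.reg z) ≤ Nat.size (s.reg y) := Nat.size_le_size (Nat.sub_le _ _)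
  exact ⟨_, _, .sub x y z s, by omega, (hw.mono (by omega)).setReg _ (by omega), h⟩

theorem load {x a i : ℕ} (h : Q (s.setReg x (s.arr a (s.reg i)))) : Runs (.load x a i) s 1 Q := by
  intro w hw
  have h1 := hw.1 i
  have h2 := hw.2 a (s.reg i)
  exact ⟨_, _, .load x a i s, by omega, (hw.mono (by omega)).setReg _ (by omega), h⟩

theorem store {a i x : ℕ} (h : Q (s.setArr a (s.reg i) (s.reg x))) :
    Runs (.store a i x) s 1 Q := by
  intro w hw
  have h1 := hw.1 i
  have h2 := hw.1 x
  exact ⟨_, _, .store a i x s, by omega, (hw.mono (by omega)).setArr _ _ (by omega), h⟩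

theorem seq {P' : Prog} (h : Runs P s K fun s' => Runs P' s' K' Q) :
    Runs (.seq P P') s (K + K') Q := by
  intro w hw
  obtain ⟨t, s', he, ht, hb, hq⟩ := h w hw
  obtain ⟨t', s'', he', ht', hb', hq'⟩ := hq _ hb
  refine ⟨_, _, .seq he he', ?_, by rwa [← add_assoc], hq'⟩
  calc t + t' ≤ K * (2 * (w + (K + K')) + 1) + K' * (2 * (w + (K + K')) + 1) := by
        refine add_le_add (ht.trans ?_) (ht'.trans ?_)
        · gcongr; omega
        · rw [add_assoc w]
    _ = _ := by ring

theorem cond {x : ℕ} {P' : Prog} (h : s.reg x ≠ 0 → Runs P s K Q)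
    (h' : s.reg x = 0 → Runs P' s K Q) : Runs (.cond x P P') s (K + 1) Q := by
  intro w hw
  have hx := hw.1 x
  by_cases h0 : s.reg x = 0
  · obtain ⟨t, s', he, ht, hb, hq⟩ := h' h0 w hw
    refine ⟨_, _, .condFalse h0 he, ?_, hb.mono (by omega), hq⟩
    nlinarith
  · obtain ⟨t, s', he, ht, hb, hq⟩ := h h0 w hw
    refine ⟨_, _, .condTrue h0 he, ?_, hb.mono (by omega), hq⟩
    nlinarith

/-- The index of the invariant `I` is a strictly decreasing variant, so its initial value `n` bounds
the number of iterations. -/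
theorem loop {x : ℕ} (I : ℕ → State → Prop)
    (hstep : ∀ m s, I m s → s.reg x ≠ 0 → Runs P s K fun s' => ∃ m' < m, I m' s') :
    ∀ n s, I n s → Runs (.loop x P) s (n * (K + 1) + 1) fun s' => s'.reg x = 0 ∧ ∃ m, I m s' := by
  intro n
  induction n using Nat.strong_induction_on with
  | _ n ih =>
  intro s hI w hw
  have hx := hw.1 x
  by_cases h0 : s.reg x = 0
  · refine ⟨_, _, .loopDone h0, ?_, hw.mono (by omega), h0, n, hI⟩
    nlinarith [Nat.zero_le (n * (K + 1))]
  · obtain ⟨t, s', he, ht, hb, m, hm, hI'⟩ := hstep n s hI h0 w hw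
    obtain ⟨t', s'', he', ht', hb', hq⟩ := ih m hm s' hI' _ hb
    have hle : K + (m * (K + 1) + 1) + 1 ≤ n * (K + 1) + 1 := by nlinarith
    refine ⟨_, _, .loopStep h0 he he', ?_, hb'.mono (by omega), hq⟩
    set W := w + (n * (K + 1) + 1) with hW
    calc 1 + Nat.size (s.reg x) + t + t'
        ≤ 1 * (2 * W + 1) + K * (2 * W + 1) + (m * (K + 1) + 1) * (2 * W + 1) := by
          refine add_le_add (add_le_add (by omega) (ht.trans ?_)) (ht'.trans ?_)
          · gcongr; omega
          · exact Nat.mul_le_mul_left _ (by omega)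
      _ = (K + (m * (K + 1) + 1) + 1) * (2 * W + 1) := by ring
      _ ≤ _ := by gcongr

end Runs

/-- Sequential composition of a list of programs. -/
def block : List Prog → Prog
  | [] => .skip
  | P :: l => .seq P (block l)

namespace Runs

variable {P : Prog} {l : List Prog} {s : State} {K K' : ℕ} {Q : State → Prop}

theorem nil (h : Q s) : Runs (block []) s (K + 1) Q := skip h

theorem cons (h : Runs P s K fun s' => Runs (block l) s' K' Q) :
    -- With the cost of the head last, a numeral budget unifies with `K' + 1` when the head costs
    -- one step.
    Runs (block (P :: l)) s (K' + K) Q := by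
  rw [Nat.add_comm]; exact seq h

theorem const_cons {x c : ℕ} (hc : c ≤ 1) (h : Runs (block l) (s.setReg x c) K Q) :
    Runs (block (.const x c :: l)) s (K + 1) Q := cons (const hc h)

theorem add_cons {x y z : ℕ} (h : Runs (block l) (s.setReg x (s.reg y + s.reg z)) K Q) :
    Runs (block (.add x y z :: l)) s (K + 1) Q := cons (add h)

theorem sub_cons {x y z : ℕ} (h : Runs (block l) (s.setReg x (s.reg y - s.reg z)) K Q) :
    Runs (block (.sub x y z :: l)) s (K + 1) Q := cons (sub h)

theorem load_cons {x a i : ℕ} (h : Runs (block l) (s.setReg x (s.arr a (s.reg i))) K Q) :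
    Runs (block (.load x a i :: l)) s (K + 1) Q := cons (load h)

theorem store_cons {a i x : ℕ} (h : Runs (block l) (s.setArr a (s.reg i) (s.reg x)) K Q) :
    Runs (block (.store a i x :: l)) s (K + 1) Q := cons (store h)

theorem loop_cons {x : ℕ} (I : ℕ → State → Prop) (n B K' : ℕ) (hK : n * (B + 1) + 1 + K' ≤ K)
    (hn : I n s)
    (hstep : ∀ m s, I m s → s.reg x ≠ 0 → Runs P s B fun s' => ∃ m' < m, I m' s')
    (hexit : ∀ m s, I m s → s.reg x = 0 → Runs (block l) s K' Q) :
    Runs (block (.loop x P :: l)) s K Q :=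
  of_le hK (seq ((loop I hstep n s hn).mono le_rfl fun s' ⟨h0, m, hm⟩ => hexit m s' hm h0))

end Runs
end RAM

open Finset

/-! ## Matrices with bounded entries and prescribed row and column sums -/

/-- `M` is an `R × C` matrix with entries at most `q`, row sums `row` and column sums `col`. -/
structure IsTransport (R C q : ℕ) (row col : ℕ → ℕ) (M : ℕ → ℕ → ℕ) : Prop where
  le : ∀ i < R, ∀ j < C, M i j ≤ q
  row_sum : ∀ i < R, ∑ j ∈ range C, M i j = row i
  col_sum : ∀ j < C, ∑ i ∈ range R, M i j = col j

/-- One unit of `M` is moved within row `i` from column `j` to column `k`. -/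
def moveUnit (M : ℕ → ℕ → ℕ) (i j k : ℕ) (x y : ℕ) : ℕ :=
  if x = i then (if y = j then M x y - 1 else if y = k then M x y + 1 else M x y) else M x y

section moveUnit

variable {M : ℕ → ℕ → ℕ} {i j k : ℕ}

/-- The corrections stand on both sides to avoid truncated subtraction; summing along a row or a
column gives the two sum lemmas. -/
theorem moveUnit_add (h : 0 < M i j) (hjk : j ≠ k) (x y : ℕ) :
    moveUnit M i j k x y + (if x = i then if y = j then 1 else 0 else 0)
      = M x y + (if x = i then if y = k then 1 else 0 else 0) := by
  unfold moveUnit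
  by_cases hx : x = i
  · subst hx
    by_cases hy : y = j
    · subst hy; simp [hjk]; omega
    · by_cases hy' : y = k
      · subst hy'; simp [hy]
      · simp [hy, hy']
  · simp [hx]

theorem sum_row_moveUnit (h : 0 < M i j) (hjk : j ≠ k) {C : ℕ} (hj : j < C) (hk : k < C) (x : ℕ) :
    ∑ y ∈ range C, moveUnit M i j k x y = ∑ y ∈ range C, M x y := by
  have := sum_congr (rfl : range C = range C) fun y _ => moveUnit_add h hjk x y
  by_cases hx : x = i <;> simpa [sum_add_distrib, hx, hj, hk] using this

theorem sum_col_moveUnit (h : 0 < M i j) (hjk : j ≠ k) {R : ℕ} (hi : i < R) (y : ℕ) :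
    ∑ x ∈ range R, moveUnit M i j k x y + (if y = j then 1 else 0)
      = ∑ x ∈ range R, M x y + (if y = k then 1 else 0) := by
  have := sum_congr (rfl : range R = range R) fun x _ => moveUnit_add h hjk x y
  simpa [sum_add_distrib, hi] using this

end moveUnit

/-- An almost constant sequence of column sums is compatible with every sequence of row sums. -/
theorem exists_isTransport_of_almostRegular {R C k : ℕ} {row col : ℕ → ℕ}
    (hrow : ∀ i < R, row i ≤ C) (hcol : ∀ j < C, col j = k ∨ col j + 1 = k)
    (hsum : ∑ i ∈ range R, row i = ∑ j ∈ range C, col j) :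
    ∃ M, IsTransport R C 1 row col M := by
  -- Induction on the total deficit of the columns, starting from the left-justified matrix, which
  -- has the right row sums.
  suffices H : ∀ n (M : ℕ → ℕ → ℕ), (∀ i < R, ∀ j < C, M i j ≤ 1) →
      (∀ i < R, ∑ j ∈ range C, M i j = row i) →
      ∑ j ∈ range C, (col j - ∑ i ∈ range R, M i j) = n → ∃ M, IsTransport R C 1 row col M by
    refine H _ (fun i j => if j < row i then 1 else 0) (fun i _ j _ => ?_) (fun i hi => ?_) rfl
    · split_ifs <;> omega
    · rw [← card_filter]
      have : (range C).filter (· < row i) = range (row i) := by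
        ext j; have := hrow i hi; simp; omega
      rw [this, card_range]
  intro n
  induction n with
  | zero =>
    intro M hM hr h0
    refine ⟨M, hM, hr, ?_⟩
    -- With no deficit every column sum is large enough, and equal totals force equality.
    have hle : ∀ j ∈ range C, col j ≤ ∑ i ∈ range R, M i j := fun j hj => by
      have := (sum_eq_zero_iff.1 h0) j hj; omega
    have htot : ∑ j ∈ range C, col j = ∑ j ∈ range C, ∑ i ∈ range R, M i j := by
      rw [sum_comm, ← hsum]
      exact sum_congr rfl fun i hi => (hr i (mem_range.1 hi)).symm
    exact fun j hj => (((sum_eq_sum_iff_of_le hle).1 htot) j (mem_range.2 hj)).symm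
  | succ n ih =>
    intro M hM hr hn
    have htot : ∑ j ∈ range C, ∑ i ∈ range R, M i j = ∑ j ∈ range C, col j := by
      rw [sum_comm, ← hsum]
      exact sum_congr rfl fun i hi => hr i (mem_range.1 hi)
    obtain ⟨b, hb, hb'⟩ : ∃ b ∈ range C, col b - ∑ i ∈ range R, M i b ≠ 0 :=
      exists_ne_zero_of_sum_ne_zero (by omega)
    obtain ⟨a, ha, ha'⟩ : ∃ a ∈ range C, col a < ∑ i ∈ range R, M i a := by
      by_contra! hcon
      have := sum_lt_sum hcon ⟨b, hb, by omega⟩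
      omega
    rw [mem_range] at ha hb
    have hab : a ≠ b := by rintro rfl; omega
    -- Column `a` has at least `col a + 1 ≥ col b` units and column `b` fewer than `col b`. Only
    -- this comparison uses that `col` is almost constant.
    obtain ⟨i, hi, hlt⟩ : ∃ i ∈ range R, M i b < M i a := by
      refine exists_lt_of_sum_lt ?_
      have := hcol a ha; have := hcol b hb; omega
    rw [mem_range] at hi
    have h1 := hM i hi a ha
    have hpos : 0 < M i a := by omega
    refine ih (moveUnit M i a b) (fun x hx y hy => ?_)
      (fun x hx => (sum_row_moveUnit hpos hab ha hb x).trans (hr x hx)) ?_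
    · have := hM x hx y hy
      unfold moveUnit
      split_ifs <;> first | omega | (subst_vars; omega)
    -- Only the deficit of `b` changes, by one: the overfull column `a` has truncated deficit zero
    -- before and after the move.
    · have key : ∀ y ∈ range C, (col y - ∑ x ∈ range R, moveUnit M i a b x y)
          + (if y = b then 1 else 0) = col y - ∑ x ∈ range R, M x y := by
        intro y hy
        have := sum_col_moveUnit hpos hab hi y
        by_cases hya : y = a
        · subst hya; simp [hab] at this ⊢; omega
        · by_cases hyb : y = b
          · subst hyb; simp [hya] at this ⊢; omega
          · simp [hya, hyb] at this ⊢; omega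
      have := sum_congr rfl key
      simp [sum_add_distrib, hb] at this
      omega

/-- The exchange argument behind the greedy algorithm: if `m` can be completed to a solution, its
rows before `i` are full, its rows after `i` are empty and its row `i` is not full, then some
completion has a further unit in row `i` and column `c`, where `c` is a column with room in row `i`
and the largest missing column sum. -/
theorem IsTransport.exists_place {R C q : ℕ} {row col : ℕ → ℕ} {m M : ℕ → ℕ → ℕ} {i c : ℕ}
    (hM : IsTransport R C q row col M) (hle : ∀ x < R, ∀ y < C, m x y ≤ M x y)
    (hi : i < R) (hc : c < C)
    (hfull : ∀ x < i, ∑ y ∈ range C, m x y = row x)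
    (hempty : ∀ x, i < x → ∀ y < C, m x y = 0)
    (hneed : ∑ y ∈ range C, m i y < row i) (hroom : m i c < q)
    (hmax : ∀ y < C, m i y < q →
      col y - ∑ x ∈ range R, m x y ≤ col c - ∑ x ∈ range R, m x c) :
    ∃ M', IsTransport R C q row col M' ∧ (∀ x < R, ∀ y < C, m x y ≤ M' x y) ∧ m i c < M' i c := by
  rcases (hle i hi c hc).lt_or_eq with hlt | heq
  · exact ⟨M, hM, hle, hlt⟩
  rw [← hM.row_sum i hi] at hneed
  obtain ⟨d, hd, hdlt⟩ := exists_lt_of_sum_lt hneed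
  rw [mem_range] at hd
  have hdc : d ≠ c := by rintro rfl; omega
  have hdq := hM.le i hi d hd
  have hcmp := hmax d hd (by omega)
  rw [← hM.col_sum d hd, ← hM.col_sum c hc] at hcmp
  have hsub : ∀ y < C, ∑ x ∈ range R, M x y - ∑ x ∈ range R, m x y
      = ∑ x ∈ range R, (M x y - m x y) := fun y hy =>
    (sum_tsub_distrib _ fun x hx => hle x (mem_range.1 hx) y hy).symm
  rw [hsub d hd, hsub c hc] at hcmp
  -- In row `i` the completion adds more to `d` than to `c`, yet over all rows it adds at least as
  -- much to `c`; some row `e` must compensate.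
  obtain ⟨e, he, helt⟩ : ∃ e ∈ range R, M e d - m e d < M e c - m e c := by
    by_contra! hcon
    have := sum_lt_sum hcon ⟨i, mem_range.2 hi, by omega⟩
    omega
  rw [mem_range] at he
  -- Rows before `i` are full, so `m` and `M` agree there, and in row `i` the inequality goes the
  -- other way.
  have hie : i < e := by
    rcases lt_trichotomy e i with h | h | h
    · have hrow := (sum_eq_sum_iff_of_le fun y hy => hle e he y (mem_range.1 hy)).1
        ((hfull e h).trans (hM.row_sum e he).symm) c (mem_range.2 hc)
      omega
    · subst h; omega
    · exact h
  rw [hempty e hie d hd, hempty e hie c hc] at helt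
  have hpos : 0 < M i d := by omega
  -- Exchange: a unit goes from `d` to `c` in row `i` and one from `c` to `d` in row `e`, so all row
  -- and column sums survive.
  set M₁ := moveUnit M i d c with hM₁
  have he₁ : ∀ y, M₁ e y = M e y := fun y => by simp [hM₁, moveUnit, hie.ne']
  have hpos₁ : 0 < M₁ e c := by rw [he₁]; omega
  refine ⟨moveUnit M₁ e c d, ⟨fun x hx y hy => ?_, fun x hx => ?_, fun y hy => ?_⟩,
    fun x hx y hy => ?_, ?_⟩
  · have h1 := hM.le x hx y hy
    have h2 := hM.le e he c hc
    simp only [hM₁, moveUnit]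
    split_ifs <;> first | omega | (subst_vars; omega)
  · rw [sum_row_moveUnit hpos₁ hdc.symm hc hd, sum_row_moveUnit hpos hdc hd hc, hM.row_sum x hx]
  · have h1 := sum_col_moveUnit hpos₁ hdc.symm he y
    have h2 := sum_col_moveUnit hpos hdc hi y
    rw [← hM₁] at h2
    rw [← hM.col_sum y hy]
    omega
  · have h1 := hle x hx y hy
    rcases eq_or_ne x e with hxe | hxe
    · subst hxe; rw [hempty x hie y hy]; exact Nat.zero_le _
    · simp only [hM₁, moveUnit, hxe, if_false]
      split_ifs <;> first | omega | (subst_vars; omega)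
  · simp [hM₁, moveUnit, hie.ne, hdc.symm]
    omega

/-! ## The state of the greedy algorithm -/

/-- `out` holds an `R × C` matrix row by row, and `rem` the missing column sums. The rows before
`i` are finished, the rows after it are empty and row `i` lacks `need` units. The number `fail`
is zero as long as all rows could be filled. -/
structure GreedyInv (R C q : ℕ) (row col : ℕ → ℕ) (fail₀ i need : ℕ) (out rem : ℕ → ℕ)
    (fail : ℕ) : Prop where
  le : ∀ x < R, ∀ y < C, out (x * C + y) ≤ q
  empty : ∀ p, (i + 1) * C ≤ p → out p = 0
  col_sum : ∀ y < C, rem y + ∑ x ∈ range R, out (x * C + y) = col y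
  row_sum : fail = 0 → ∀ x < i, ∑ y ∈ range C, out (x * C + y) = row x
  row_need : fail = 0 → ∑ y ∈ range C, out (i * C + y) + need = row i
  fail_mono : fail = 0 → fail₀ = 0
  extends_of_exists : fail₀ = 0 → (∃ M, IsTransport R C q row col M) →
    fail = 0 ∧ ∃ M, IsTransport R C q row col M ∧ ∀ x < R, ∀ y < C, out (x * C + y) ≤ M x y

/-! ### Row-by-row addressing and preservation of the greedy invariant -/

theorem mul_add_inj {C x y x' y' : ℕ} (hy : y < C) (hy' : y' < C)
    (h : x * C + y = x' * C + y') : x = x' ∧ y = y' := by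
  have hC : 0 < C := by omega
  have h1 := congrArg (· / C) h
  have h2 := congrArg (· % C) h
  simp only [Nat.mul_comm _ C, Nat.mul_add_div hC, Nat.mul_add_mod, Nat.div_eq_of_lt hy,
    Nat.div_eq_of_lt hy', Nat.mod_eq_of_lt hy, Nat.mod_eq_of_lt hy'] at h1 h2
  exact ⟨by simpa using h1, h2⟩

theorem update_mul_add {C i c v : ℕ} (hc : c < C) (out : ℕ → ℕ) (x : ℕ) {y : ℕ} (hy : y < C) :
    Function.update out (i * C + c) v (x * C + y)
      = if x = i ∧ y = c then v else out (x * C + y) := by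
  by_cases h : x = i ∧ y = c
  · obtain ⟨rfl, rfl⟩ := h; simp
  · rw [if_neg h, Function.update_of_ne]
    exact fun he => h (mul_add_inj hy hc he)

namespace GreedyInv

variable {R C q : ℕ} {row col : ℕ → ℕ} {fail₀ i need fail : ℕ} {out rem : ℕ → ℕ}

theorem place (h : GreedyInv R C q row col fail₀ i need out rem fail) (hi : i < R)
    (hneed : need ≠ 0) {c : ℕ} (hc : c < C) (hroom : out (i * C + c) < q) (hrem : rem c ≠ 0)
    (hmax : ∀ y < C, out (i * C + y) < q → rem y ≤ rem c) :
    GreedyInv R C q row col fail₀ i (need - 1)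
      (Function.update out (i * C + c) (out (i * C + c) + 1))
      (Function.update rem c (rem c - 1)) fail := by
  have hupd := fun x y hy => update_mul_add (i := i) (v := out (i * C + c) + 1) hc out x (y := y) hy
  have hother : ∀ x, x ≠ i → ∑ y ∈ range C, Function.update out (i * C + c)
      (out (i * C + c) + 1) (x * C + y) = ∑ y ∈ range C, out (x * C + y) := fun x hx =>
    sum_congr rfl fun y hy => by rw [hupd x y (mem_range.1 hy), if_neg (by tauto)]
  have hsplit : ∀ x, ∀ y < C, Function.update out (i * C + c) (out (i * C + c) + 1) (x * C + y)
      = out (x * C + y) + if x = i then if y = c then 1 else 0 else 0 := fun x y hy => by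
    rw [hupd x y hy]
    by_cases hx : x = i
    · by_cases hyc : y = c <;> simp [hx, hyc]
    · simp [hx]
  refine ⟨fun x hx y hy => ?_, fun p hp => ?_, fun y hy => ?_, fun hf x hx => ?_, fun hf => ?_,
    h.fail_mono, fun h0 hex => ?_⟩
  · rw [hupd x y hy]
    split_ifs
    · omega
    · exact h.le x hx y hy
  · rw [Function.update_of_ne, h.empty p hp]
    rw [add_mul] at hp
    omega
  · rw [sum_congr rfl fun x _ => hsplit x y hy, sum_add_distrib, ← h.col_sum y hy]
    by_cases hyc : y = c
    · subst hyc; simp [hi]; omega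
    · simp [hyc]
  · rw [hother x hx.ne, h.row_sum hf x hx]
  · rw [sum_congr rfl fun y hy => hsplit i y (mem_range.1 hy), sum_add_distrib,
      ← h.row_need hf]
    simp [hc]; omega
  · obtain ⟨hf, M, hM, hle⟩ := h.extends_of_exists h0 hex
    -- This identifies `rem` with the missing sums of the exchange argument, so that `hmax` is the
    -- required maximality.
    have hrem' : ∀ y < C, col y - ∑ x ∈ range R, out (x * C + y) = rem y := fun y hy => by
      have := h.col_sum y hy; omega
    obtain ⟨M', hM', hle', hlt⟩ := hM.exists_place (m := fun x y => out (x * C + y)) hle hi hc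
      (h.row_sum hf) (fun x hx y _ => h.empty _ (le_add_right (Nat.mul_le_mul_right C hx)))
      (by have := h.row_need hf; omega) hroom
      (fun y hy hyq => by rw [hrem' y hy, hrem' c hc]; exact hmax y hy hyq)
    refine ⟨hf, M', hM', fun x hx y hy => ?_⟩
    rw [hupd x y hy]
    split_ifs with hxy
    · rw [hxy.1, hxy.2]; exact hlt
    · exact hle' x hx y hy

/-- A completion would add a unit to row `i` in some column, which then has room; but there the
column sum is already exhausted. Hence no completion exists and the failure is justified. -/
theorem stuck (h : GreedyInv R C q row col fail₀ i need out rem fail) (hi : i < R)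
    (hneed : need ≠ 0) (hno : ∀ y < C, out (i * C + y) < q → rem y = 0) :
    GreedyInv R C q row col fail₀ i 0 out rem 1 := by
  refine ⟨h.le, h.empty, h.col_sum, by simp, by simp, by simp, fun h0 hex => ?_⟩
  exfalso
  obtain ⟨hf, M, hM, hle⟩ := h.extends_of_exists h0 hex
  have hlt : ∑ y ∈ range C, out (i * C + y) < ∑ y ∈ range C, M i y := by
    rw [hM.row_sum i hi, ← h.row_need hf]; omega
  obtain ⟨y, hy, hylt⟩ := exists_lt_of_sum_lt hlt
  rw [mem_range] at hy
  have h1 := h.col_sum y hy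
  rw [hno y hy (hylt.trans_le (hM.le i hi y hy)), ← hM.col_sum y hy] at h1
  have := sum_lt_sum (fun x hx => hle x (mem_range.1 hx) y hy) ⟨i, mem_range.2 hi, hylt⟩
  omega

theorem next (h : GreedyInv R C q row col fail₀ i 0 out rem fail) :
    GreedyInv R C q row col fail₀ (i + 1) (row (i + 1)) out rem fail := by
  have hz : ∀ y, out ((i + 1) * C + y) = 0 := fun y => h.empty _ (by omega)
  refine ⟨h.le, fun p hp => h.empty p ?_, h.col_sum, fun hf x hx => ?_, fun _ => by simp [hz],
    h.fail_mono, h.extends_of_exists⟩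
  · rw [add_mul] at hp; omega
  · rcases Nat.lt_succ_iff_lt_or_eq.1 hx with hx | rfl
    · exact h.row_sum hf x hx
    · simpa using h.row_need hf

theorem init (fail₀ : ℕ) : GreedyInv R C q row col fail₀ 0 (row 0) (fun _ => 0) col fail₀ :=
  ⟨by simp, by simp, by simp, by simp, by simp, id, fun h0 ⟨M, hM⟩ => ⟨h0, M, hM, by simp⟩⟩

theorem isTransport (h : GreedyInv R C q row col fail₀ R need out rem fail) (hf : fail = 0)
    (hrem : ∀ y < C, rem y = 0) : IsTransport R C q row col fun x y => out (x * C + y) :=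
  ⟨h.le, h.row_sum hf, fun y hy => by rw [← h.col_sum y hy, hrem y hy, zero_add]⟩

/-- Once all rows are full, a completion above `out` has the same row sums and so coincides with it;
its column sums leave nothing missing. -/
theorem rem_eq_zero (h : GreedyInv R C q row col fail₀ R need out rem fail) (h0 : fail₀ = 0)
    (hex : ∃ M, IsTransport R C q row col M) : fail = 0 ∧ ∀ y < C, rem y = 0 := by
  obtain ⟨hf, M, hM, hle⟩ := h.extends_of_exists h0 hex
  refine ⟨hf, fun y hy => ?_⟩
  have : ∑ x ∈ range R, out (x * C + y) = ∑ x ∈ range R, M x y := sum_congr rfl fun x hx => by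
    rw [mem_range] at hx
    exact (sum_eq_sum_iff_of_le fun z hz => hle x hx z (mem_range.1 hz)).1
      ((h.row_sum hf x hx).trans (hM.row_sum x hx).symm) y (mem_range.2 hy)
  have h1 := h.col_sum y hy
  have h2 := hM.col_sum y hy
  omega

end GreedyInv

namespace RAM

/-! ## The greedy program

Registers `5` and `6` hold the constants `1` and `0`; registers `8`, `9`, `10` hold the numbers of
rows and columns and the bound on the entries, and register `11` is set to `1` on failure. The row
sums are in array `r`, the column sums in array `c` (which is consumed), and the matrix is written
to array `o`. -/

/-- Inspect column `j = reg 18` of the row starting at address `reg 12`; the best column so far and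
its missing sum are in registers `17` and `16`. -/
def scanStep (c o : ℕ) : Prog := block
  [.add 20 12 18, .load 21 o 20, .sub 22 10 21,
   .cond 22 (block [.load 21 c 18, .sub 22 21 16,
     .cond 22 (block [.add 16 21 6, .add 17 18 6]) .skip]) .skip,
   .add 18 18 5, .sub 19 19 5]

/-- Find the column with room in the current row that has the largest missing sum. -/
def scan (c o : ℕ) : Prog := block
  [.const 16 0, .const 18 0, .add 19 9 6, .loop 19 (scanStep c o)]

/-- Put one more unit into the current row, or give up the row. -/
def placeStep (c o : ℕ) : Prog := block
  [scan c o,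
   .cond 16
    (block [.add 20 12 17, .load 21 o 20, .add 21 21 5, .store o 20 21, .sub 16 16 5,
      .store c 17 16, .sub 15 15 5])
    (block [.const 15 0, .const 11 1])]

/-- Fill row number `reg 13` and go on to the next one. -/
def rowStep (r c o : ℕ) : Prog := block
  [.load 15 r 13, .loop 15 (placeStep c o), .add 12 12 9, .add 13 13 5, .sub 14 14 5]

/-- Report failure if the missing sum of column `reg 18` is not zero. -/
def checkStep (c : ℕ) : Prog := block
  [.load 21 c 18, .cond 21 (.const 11 1) .skip, .add 18 18 5, .sub 19 19 5]

/-- The greedy algorithm. -/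
def greedy (r c o : ℕ) : Prog := block
  [.const 12 0, .const 13 0, .add 14 8 6, .loop 14 (rowStep r c o),
   .const 18 0, .add 19 9 6, .loop 19 (checkStep c)]

/-! ### Correctness and step count of the greedy program -/

theorem runs_scanStep (c o : ℕ) (s : State) (h5 : s.reg 5 = 1) (h6 : s.reg 6 = 0) :
    Runs (scanStep c o) s 20 fun s' => (∀ x < 16, s'.reg x = s.reg x) ∧ s'.arr = s.arr ∧
      s'.reg 18 = s.reg 18 + 1 ∧ s'.reg 19 = s.reg 19 - 1 ∧
      if s.arr o (s.reg 12 + s.reg 18) < s.reg 10 ∧ s.reg 16 < s.arr c (s.reg 18) then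
        s'.reg 16 = s.arr c (s.reg 18) ∧ s'.reg 17 = s.reg 18
      else s'.reg 16 = s.reg 16 ∧ s'.reg 17 = s.reg 17 := by
  -- Truncated subtraction serves as the strict comparison: the first test asks for room, the second
  -- for a larger missing sum. Adding register `6`, which is zero, copies.
  refine .add_cons (.load_cons (.sub_cons (.cons (K := 11) (K' := 6) (.cond (fun h => ?_)
    fun h => ?_))))
  · refine .load_cons (.sub_cons (.cons (K := 5) (K' := 3) (.cond (fun h' => ?_) fun h' => ?_)))
    · refine .add_cons (.add_cons (.nil (.nil (.add_cons (.sub_cons (.nil ?_))))))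
      simp [Nat.sub_eq_zero_iff_le] at h h'
      refine ⟨fun x hx => ?_, ?_⟩
      · simp (disch := omega)
      · simp [h5, h6, h, h']
    · refine .skip (.nil (.add_cons (.sub_cons (.nil ?_))))
      simp [Nat.sub_eq_zero_iff_le] at h h'
      refine ⟨fun x hx => ?_, ?_⟩
      · simp (disch := omega)
      · simp [h5, h'.not_gt]
  · refine .skip (.add_cons (.sub_cons (.nil ?_)))
    simp [Nat.sub_eq_zero_iff_le] at h
    refine ⟨fun x hx => ?_, ?_⟩
    · simp (disch := omega)
    · simp [h5, h.not_gt]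

/-- The best value starts at zero and only strict improvements count, so a final zero means that no
column with room has anything missing; register `17` is then meaningless. -/
theorem runs_scan (c o : ℕ) (s : State) (h5 : s.reg 5 = 1) (h6 : s.reg 6 = 0) :
    Runs (scan c o) s (21 * s.reg 9 + 5) fun s' => (∀ x < 16, s'.reg x = s.reg x) ∧
      s'.arr = s.arr ∧
      (s'.reg 16 ≠ 0 → s'.reg 17 < s.reg 9 ∧ s.arr o (s.reg 12 + s'.reg 17) < s.reg 10 ∧
        s.arr c (s'.reg 17) = s'.reg 16) ∧
      ∀ y < s.reg 9, s.arr o (s.reg 12 + y) < s.reg 10 → s.arr c y ≤ s'.reg 16 := by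
  refine .const_cons (by omega) (.const_cons (by omega) (.add_cons (.loop_cons
    (fun m s' => (∀ x < 16, s'.reg x = s.reg x) ∧ s'.arr = s.arr ∧ s'.reg 19 = m ∧
      s'.reg 19 + s'.reg 18 = s.reg 9 ∧
      (s'.reg 16 ≠ 0 → s'.reg 17 < s.reg 9 ∧ s.arr o (s.reg 12 + s'.reg 17) < s.reg 10 ∧
        s.arr c (s'.reg 17) = s'.reg 16) ∧
      ∀ y < s'.reg 18, s.arr o (s.reg 12 + y) < s.reg 10 → s.arr c y ≤ s'.reg 16)
    (s.reg 9) 20 1 (by omega) ?_ ?_ ?_)))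
  · refine ⟨fun x hx => ?_, ?_⟩
    · simp (disch := omega)
    · simp [h6]
  · rintro m s' ⟨hlow, harr, rfl, hj, hbest, hall⟩ hne
    refine (runs_scanStep c o s' ?_ ?_).mono le_rfl ?_
    · rw [hlow 5 (by omega), h5]
    · rw [hlow 6 (by omega), h6]
    · rintro t ⟨hlow', harr', h18, h19, hif⟩
      rw [harr, hlow 12 (by omega), hlow 10 (by omega)] at hif
      refine ⟨_, ?_, fun x hx => by rw [hlow' x hx, hlow x hx], by rw [harr', harr], rfl,
        by omega, ?_⟩
      · omega
      · rw [h18]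
        split_ifs at hif with hc
        · rw [hif.1, hif.2]
          refine ⟨fun _ => ⟨by omega, hc.1, rfl⟩, fun y hy hyo => ?_⟩
          rcases Nat.lt_succ_iff_lt_or_eq.1 hy with hy | rfl
          · exact (hall y hy hyo).trans hc.2.le
          · exact le_rfl
        · rw [hif.1, hif.2]
          refine ⟨hbest, fun y hy hyo => ?_⟩
          rcases Nat.lt_succ_iff_lt_or_eq.1 hy with hy | rfl
          · exact hall y hy hyo
          · exact not_lt.1 fun hlt => hc ⟨hyo, hlt⟩
  · rintro m t ⟨hlow, harr, -, hj, hbest, hall⟩ h0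
    refine .nil ⟨hlow, harr, hbest, ?_⟩
    rwa [show t.reg 18 = s.reg 9 by omega] at hall

/-- The memory `s` while row number `i` is being filled, the memory at the start being `s₀`. -/
structure Filling (r c o : ℕ) (s₀ : State) (i need : ℕ) (s : State) : Prop where
  low : ∀ x < 11, s.reg x = s₀.reg x
  arr : ∀ a, a ≠ c → a ≠ o → s.arr a = s₀.arr a
  base : s.reg 12 = i * s₀.reg 9
  idx : s.reg 13 = i
  left : s.reg 14 + i = s₀.reg 8
  inv : GreedyInv (s₀.reg 8) (s₀.reg 9) (s₀.reg 10) (s₀.arr r) (s₀.arr c) (s₀.reg 11) i need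
    (s.arr o) (s.arr c) (s.reg 11)

section greedy

variable {r c o : ℕ} {s₀ : State} {i : ℕ}

/-- Progress is measured by the free capacity of the row and not by `need`, which can be exponential
in the input length. -/
theorem Filling.runs_placeStep (hco : c ≠ o) (h5 : s₀.reg 5 = 1) (h6 : s₀.reg 6 = 0) {s : State}
    (h : Filling r c o s₀ i (s.reg 15) s) (hi : i < s₀.reg 8) (hne : s.reg 15 ≠ 0) :
    Runs (placeStep c o) s (21 * s₀.reg 9 + 16) fun s' => Filling r c o s₀ i (s'.reg 15) s' ∧
      (s'.reg 15 = 0 ∨ ∑ y ∈ range (s₀.reg 9), (s₀.reg 10 - s'.arr o (i * s₀.reg 9 + y))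
        < ∑ y ∈ range (s₀.reg 9), (s₀.reg 10 - s.arr o (i * s₀.reg 9 + y))) := by
  refine .of_le (K := 11 + (21 * s.reg 9 + 5)) (by rw [h.low 9 (by omega)]; omega)
    (.cons ((runs_scan c o s ?_ ?_).mono le_rfl ?_))
  · rw [h.low 5 (by omega), h5]
  · rw [h.low 6 (by omega), h6]
  rintro t ⟨hlow, harr, hbest, hall⟩
  rw [h.low 9 (by omega), h.base, h.low 10 (by omega)] at hbest hall
  refine .cons (K := 10) (K' := 1) (.cond (fun h0 => ?_) fun h0 => ?_)
  · obtain ⟨hlt, hroom, hrem⟩ := hbest h0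
    refine .add_cons (.load_cons (.add_cons (.store_cons (.sub_cons (.store_cons (.sub_cons
      (.nil (.nil ?_))))))))
    have hinv := h.inv.place hi hne hlt hroom (by rwa [hrem])
      (fun y hy hyo => (hall y hy hyo).trans_eq hrem.symm)
    have e5 : t.reg 5 = 1 := by rw [hlow 5 (by omega), h.low 5 (by omega), h5]
    have e12 : t.reg 12 = i * s₀.reg 9 := by rw [hlow 12 (by omega), h.base]
    have e15 : t.reg 15 = s.reg 15 := hlow 15 (by omega)
    refine ⟨⟨fun x hx => ?_, fun a hac hao => ?_, ?_, ?_, ?_, ?_⟩, .inr ?_⟩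
    · simp (disch := omega)
      rw [hlow x (by omega), h.low x hx]
    · simp [hac, hao, harr, h.arr a hac hao]
    · simp [e12]
    · simpa [hlow] using h.idx
    · simpa [hlow] using h.left
    · simpa [e5, e12, e15, hco, hco.symm, harr, hlow 11 (by omega), hrem] using hinv
    · simp only [State.reg_setReg_same, State.arr_setReg, State.arr_setArr_same, State.reg_setArr,
        ne_eq, hco.symm, not_false_eq_true, State.arr_setArr_ne,
        Nat.reduceEqDiff, State.reg_setReg_ne, harr, e5, e12]
      refine sum_lt_sum (fun y hy => ?_) ⟨t.reg 17, mem_range.2 hlt, ?_⟩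
      · rw [update_mul_add hlt _ _ (mem_range.1 hy)]
        split_ifs with hy'
        · rw [hy'.2]; omega
        · exact le_rfl
      · rw [update_mul_add hlt _ _ hlt]
        simp
        omega
  · refine .const_cons (by omega) (.const_cons (by omega) (.nil (.nil ?_)))
    have hinv := h.inv.stuck hi hne (fun y hy hyo => by simpa [h0] using hall y hy hyo)
    refine ⟨⟨fun x hx => ?_, fun a hac hao => ?_, ?_, ?_, ?_, ?_⟩, .inl ?_⟩
    · simp (disch := omega)
      rw [hlow x (by omega), h.low x hx]
    · simp [harr, h.arr a hac hao]
    · simp [hlow, h.base]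
    · simpa [hlow] using h.idx
    · simpa [hlow] using h.left
    · simpa [harr] using hinv
    · simp

/-- A bound for the number of steps that are needed to fill one row. -/
def rowSteps (C q : ℕ) : ℕ := (C * q + 1) * (21 * C + 17) + 6

theorem Filling.runs_rowStep (hco : c ≠ o) (hrc : r ≠ c) (hro : r ≠ o) (h5 : s₀.reg 5 = 1)
    (h6 : s₀.reg 6 = 0) {s : State} (h : Filling r c o s₀ i (s₀.arr r i) s) (hi : i < s₀.reg 8) :
    Runs (rowStep r c o) s (rowSteps (s₀.reg 9) (s₀.reg 10)) fun s' =>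
      Filling r c o s₀ (i + 1) (s₀.arr r (i + 1)) s' := by
  refine .load_cons (.loop_cons
    (fun m s' => Filling r c o s₀ i (s'.reg 15) s' ∧ (s'.reg 15 = 0 ∨
      ∑ y ∈ range (s₀.reg 9), (s₀.reg 10 - s'.arr o (i * s₀.reg 9 + y)) < m))
    -- At most `C * q` units fit into the row, and one further iteration may be spent on giving up.
    (s₀.reg 9 * s₀.reg 10 + 1) (21 * s₀.reg 9 + 16) 4 le_rfl ?_ ?_ ?_)
  · refine ⟨⟨fun x hx => ?_, fun a hac hao => ?_, ?_, ?_, ?_, ?_⟩, .inr ?_⟩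
    · simp (disch := omega)
      rw [h.low x hx]
    · simp [h.arr a hac hao]
    · simp [h.base]
    · simpa using h.idx
    · simpa using h.left
    · simpa [h.idx, h.arr r hrc hro] using h.inv
    · refine Nat.lt_succ_of_le ((sum_le_card_nsmul _ _ (s₀.reg 10) fun y _ => ?_).trans ?_)
      · omega
      · simp
  · rintro m s' ⟨hs', hm⟩ hne
    refine (hs'.runs_placeStep hco h5 h6 hi hne).mono le_rfl ?_
    rintro t ⟨ht, hm'⟩
    exact ⟨m - 1, by omega, ht, by omega⟩
  · rintro m s' ⟨hs', -⟩ h0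
    rw [h0] at hs'
    refine .add_cons (.add_cons (.sub_cons (.nil ?_)))
    have e5 : s'.reg 5 = 1 := by rw [hs'.low 5 (by omega), h5]
    refine ⟨fun x hx => ?_, fun a hac hao => ?_, ?_, ?_, ?_, ?_⟩
    · simp (disch := omega)
      rw [hs'.low x hx]
    · simp [hs'.arr a hac hao]
    · simp [hs'.base, hs'.low 9, add_mul]
    · simp [hs'.idx, e5]
    · have := hs'.left
      simp [e5]
      omega
    · simpa using hs'.inv.next

/-- A bound for the number of steps of the greedy algorithm. -/
def greedySteps (R C q : ℕ) : ℕ := R * (rowSteps C q + 1) + 8 * C + 10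

/-- The final value of register `12` is recorded because it is the product `R * C`, the number of
rows of the second run, obtained without a multiplication instruction. -/
theorem runs_greedy (hco : c ≠ o) (hrc : r ≠ c) (hro : r ≠ o) (h5 : s₀.reg 5 = 1)
    (h6 : s₀.reg 6 = 0) (ho : s₀.arr o = fun _ => 0) :
    Runs (greedy r c o) s₀ (greedySteps (s₀.reg 8) (s₀.reg 9) (s₀.reg 10)) fun s' =>
      (∀ x < 11, s'.reg x = s₀.reg x) ∧ (∀ a, a ≠ c → a ≠ o → s'.arr a = s₀.arr a) ∧
      s'.reg 12 = s₀.reg 8 * s₀.reg 9 ∧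
      (s'.reg 11 = 0 → s₀.reg 11 = 0 ∧ IsTransport (s₀.reg 8) (s₀.reg 9) (s₀.reg 10)
        (s₀.arr r) (s₀.arr c) fun x y => s'.arr o (x * s₀.reg 9 + y)) ∧
      (s₀.reg 11 = 0 → (∃ M, IsTransport (s₀.reg 8) (s₀.reg 9) (s₀.reg 10)
        (s₀.arr r) (s₀.arr c) M) → s'.reg 11 = 0) := by
  refine .const_cons (by omega) (.const_cons (by omega) (.add_cons (.loop_cons
    (fun m s => s.reg 14 = m ∧ ∃ i, Filling r c o s₀ i (s₀.arr r i) s)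
    (s₀.reg 8) (rowSteps (s₀.reg 9) (s₀.reg 10)) (8 * s₀.reg 9 + 6)
    (by show _ ≤ s₀.reg 8 * _ + 8 * s₀.reg 9 + 7; omega) ?_ ?_ ?_)))
  · refine ⟨by simp [h6], 0, fun x hx => ?_, fun a _ _ => ?_, ?_, ?_, ?_, ?_⟩
    · simp (disch := omega)
    · simp
    · simp
    · simp
    · simp [h6]
    · simpa [ho] using GreedyInv.init _
  · rintro m s ⟨rfl, i, hs⟩ hne
    refine (hs.runs_rowStep hco hrc hro h5 h6 (by have := hs.left; omega)).mono le_rfl ?_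
    intro t ht
    exact ⟨_, by have := hs.left; have := ht.left; omega, rfl, _, ht⟩
  · rintro m s ⟨-, i, hs⟩ h0
    obtain rfl : i = s₀.reg 8 := by have := hs.left; omega
    refine .const_cons (by omega) (.add_cons (.loop_cons
      (fun m s' => s'.reg 19 = m ∧ s'.reg 19 + s'.reg 18 = s₀.reg 9 ∧
        -- The flag can only be raised during the check, so earlier failures persist.
        (∀ x < 11, s'.reg x = s₀.reg x) ∧ s'.arr = s.arr ∧ s'.reg 12 = s.reg 12 ∧
        (s'.reg 11 = 0 ↔ s.reg 11 = 0 ∧ ∀ y < s'.reg 18, s.arr c y = 0))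
      (s₀.reg 9) 7 3 (by omega) ?_ ?_ ?_))
    · refine ⟨?_, ?_, fun x hx => ?_, ?_⟩
      · simp [hs.low, h6]
      · simp [hs.low, h6]
      · simp (disch := omega)
        exact hs.low x hx
      · simp
    · rintro m t ⟨rfl, hj, hlow, harr, h12, hiff⟩ hne
      have hall : ∀ n, (∀ y ≤ n, s.arr c y = 0) ↔ (∀ y < n, s.arr c y = 0) ∧ s.arr c n = 0 :=
        fun n => by simp [le_iff_lt_or_eq, or_imp, forall_and]
      refine .load_cons (.cons (K := 3) (K' := 3) (.cond (fun h => ?_) fun h => ?_))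
      · refine .of_le (by omega) (.const (by omega) (.add_cons (.sub_cons (.nil ?_))))
        simp [harr] at h
        refine ⟨_, ?_, rfl, ?_, fun x hx => ?_, ?_, ?_, ?_⟩
        · simp [hlow, h5]; omega
        · simp [hlow, h5]; omega
        · simp (disch := omega)
          exact hlow x hx
        · simp [harr]
        · simp [h12]
        · simp [hlow, h5, Nat.lt_succ_iff, hall, h]
      · refine .skip (.add_cons (.sub_cons (.nil ?_)))
        simp [harr] at h
        refine ⟨_, ?_, rfl, ?_, fun x hx => ?_, ?_, ?_, ?_⟩
        · simp [hlow, h5]; omega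
        · simp [hlow, h5]; omega
        · simp (disch := omega)
          exact hlow x hx
        · simp [harr]
        · simp [h12]
        · simp [hlow, h5, Nat.lt_succ_iff, hall, h, hiff]
    · rintro m t ⟨-, hj, hlow, harr, h12, hiff⟩ h19
      rw [show t.reg 18 = s₀.reg 9 by omega] at hiff
      refine .nil ⟨hlow, fun a hac hao => by rw [harr, hs.arr a hac hao], by rw [h12, hs.base],
        fun h11 => ?_, fun h11 hex => ?_⟩
      · obtain ⟨hf, hz⟩ := hiff.1 h11
        rw [harr]
        exact ⟨hs.inv.fail_mono hf, hs.inv.isTransport hf hz⟩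
      · exact hiff.2 (hs.inv.rem_eq_zero h11 hex)

end greedy

end RAM

namespace RAM

/-! ## Writing the list of hyperedges -/

/-- List the triple `(reg 17, reg 13, reg 15)` if cell `reg 20` of array `7` is not zero. -/
def emitStep : Prog := block
  [.load 21 7 20,
   .cond 21 (block [.store 3 4 17, .store 4 4 13, .store 5 4 15, .add 4 4 5]) .skip,
   .add 20 20 5, .add 17 17 5, .sub 18 18 5]

/-- List the hyperedges with given second and third vertices. -/
def emitPair : Prog := block
  [.const 17 0, .add 18 0 6, .loop 18 emitStep, .add 15 15 5, .sub 16 16 5]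

/-- List the hyperedges with a given second vertex. -/
def emitRow : Prog := block
  [.const 15 0, .add 16 2 6, .loop 16 emitPair, .add 13 13 5, .sub 14 14 5]

/-- List all hyperedges. -/
def emit : Prog := block
  [.const 13 0, .const 20 0, .add 14 1 6, .loop 14 emitRow]

/-- The triples `(a, b, c)` with `a < n₁` whose entry in `f` is not zero. -/
def pairTriples (f : ℕ → ℕ) (n₁ n₃ b c n : ℕ) : List (ℕ × ℕ × ℕ) :=
  (List.range n).flatMap fun a => if f ((b * n₃ + c) * n₁ + a) = 0 then [] else [(a, b, c)]

/-- The triples `(a, b, c)` with `a < n₁` and `c < n` whose entry in `f` is not zero. -/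
def rowTriples (f : ℕ → ℕ) (n₁ n₃ b n : ℕ) : List (ℕ × ℕ × ℕ) :=
  (List.range n).flatMap fun c => pairTriples f n₁ n₃ b c n₁

/-- The triples `(a, b, c)` with `a < n₁`, `b < n` and `c < n₃` whose entry in `f` is not zero. -/
def triples (f : ℕ → ℕ) (n₁ n₃ n : ℕ) : List (ℕ × ℕ × ℕ) :=
  (List.range n).flatMap fun b => rowTriples f n₁ n₃ b n₃

theorem mem_pairTriples {f : ℕ → ℕ} {n₁ n₃ b c n : ℕ} {e : ℕ × ℕ × ℕ} :
    e ∈ pairTriples f n₁ n₃ b c n ↔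
      e.1 < n ∧ e.2.1 = b ∧ e.2.2 = c ∧ f ((b * n₃ + c) * n₁ + e.1) ≠ 0 := by
  obtain ⟨x, y, z⟩ := e
  simp only [pairTriples, List.mem_flatMap, List.mem_range]
  constructor
  · rintro ⟨a, ha, h⟩
    split_ifs at h with h0
    · simp at h
    · simp only [List.mem_singleton, Prod.mk.injEq] at h
      obtain ⟨rfl, rfl, rfl⟩ := h
      exact ⟨ha, rfl, rfl, h0⟩
  · rintro ⟨hx, rfl, rfl, h0⟩
    exact ⟨x, hx, by simp_all⟩

theorem mem_rowTriples {f : ℕ → ℕ} {n₁ n₃ b n : ℕ} {e : ℕ × ℕ × ℕ} :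
    e ∈ rowTriples f n₁ n₃ b n ↔
      e.1 < n₁ ∧ e.2.1 = b ∧ e.2.2 < n ∧ f ((b * n₃ + e.2.2) * n₁ + e.1) ≠ 0 := by
  simp only [rowTriples, List.mem_flatMap, List.mem_range, mem_pairTriples]
  constructor
  · rintro ⟨c, hc, h1, h2, rfl, h4⟩
    exact ⟨h1, h2, hc, h4⟩
  · rintro ⟨h1, h2, h3, h4⟩
    exact ⟨_, h3, h1, h2, rfl, h4⟩

theorem mem_triples {f : ℕ → ℕ} {n₁ n₃ n : ℕ} {e : ℕ × ℕ × ℕ} :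
    e ∈ triples f n₁ n₃ n ↔
      e.1 < n₁ ∧ e.2.1 < n ∧ e.2.2 < n₃ ∧ f ((e.2.1 * n₃ + e.2.2) * n₁ + e.1) ≠ 0 := by
  simp only [triples, List.mem_flatMap, List.mem_range, mem_rowTriples]
  constructor
  · rintro ⟨c, hc, h1, rfl, h3, h4⟩
    exact ⟨h1, hc, h3, h4⟩
  · rintro ⟨h1, h2, h3, h4⟩
    exact ⟨_, h2, h1, rfl, h3, h4⟩

/-- Sublists for different parameters are disjoint because each parameter is a coordinate of the
triples. -/
theorem nodup_triples (f : ℕ → ℕ) (n₁ n₃ n : ℕ) : (triples f n₁ n₃ n).Nodup := by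
  refine List.nodup_flatMap.2 ⟨fun b _ => List.nodup_flatMap.2 ⟨fun c _ =>
    List.nodup_flatMap.2 ⟨fun a _ => ?_, ?_⟩, ?_⟩, ?_⟩
  · split_ifs <;> simp
  · refine List.nodup_range.imp fun {x y} hxy e he he' => hxy ?_
    dsimp only at he he'
    split_ifs at he he' <;> simp_all
  · refine List.nodup_range.imp fun {x y} hxy e he he' => hxy ?_
    rw [mem_pairTriples] at he he'
    exact he.2.2.1.symm.trans he'.2.2.1
  · refine List.nodup_range.imp fun {x y} hxy e he he' => hxy ?_
    rw [mem_rowTriples] at he he'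
    exact he.2.1.symm.trans he'.2.1

/-! ### Correctness and step count of the output loops -/

variable {s : State}

theorem State.edgeList_congr {s s' : State} (h4 : s'.reg 4 = s.reg 4)
    (h : s'.arr = s.arr) : s'.edgeList = s.edgeList := by
  simp [State.edgeList, h4, h]

theorem State.edgeList_push {s s' : State} {x y z : ℕ} (h4 : s'.reg 4 = s.reg 4 + 1)
    (h₃ : s'.arr 3 = Function.update (s.arr 3) (s.reg 4) x)
    (h₄ : s'.arr 4 = Function.update (s.arr 4) (s.reg 4) y)
    (h₅ : s'.arr 5 = Function.update (s.arr 5) (s.reg 4) z) :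
    s'.edgeList = s.edgeList ++ [(x, y, z)] := by
  rw [State.edgeList, State.edgeList, h4, List.range_succ, List.map_append]
  congr 1
  · refine List.map_congr_left fun e he => ?_
    have := (List.mem_range.1 he).ne
    simp [h₃, h₄, h₅, this]
  · simp [h₃, h₄, h₅]

theorem runs_emitStep (h5 : s.reg 5 = 1) :
    Runs emitStep s 11 fun s' => (∀ x < 17, x ≠ 4 → s'.reg x = s.reg x) ∧
      s'.arr 7 = s.arr 7 ∧ s'.reg 20 = s.reg 20 + 1 ∧ s'.reg 17 = s.reg 17 + 1 ∧
      s'.reg 18 = s.reg 18 - 1 ∧ s'.edgeList = s.edgeList ++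
        if s.arr 7 (s.reg 20) = 0 then [] else [(s.reg 17, s.reg 13, s.reg 15)] := by
  refine .load_cons (.cons (K := 6) (K' := 4) (.cond (fun h => ?_) fun h => ?_))
  · refine .store_cons (.store_cons (.store_cons (.add_cons (.nil
      (.add_cons (.add_cons (.sub_cons (.nil ?_))))))))
    simp at h
    refine ⟨fun x hx hx4 => ?_, ?_, ?_, ?_, ?_, ?_⟩
    · simp (disch := omega)
    · simp
    · simp [h5]
    · simp [h5]
    · simp [h5]
    · rw [if_neg h]
      refine State.edgeList_push ?_ ?_ ?_ ?_ <;> simp [h5]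
  · refine .skip (.add_cons (.add_cons (.sub_cons (.nil ?_))))
    simp at h
    refine ⟨fun x hx hx4 => ?_, ?_, ?_, ?_, ?_, ?_⟩
    · simp (disch := omega)
    · simp
    · simp [h5]
    · simp [h5]
    · simp [h5]
    · rw [if_pos h, List.append_nil]
      exact State.edgeList_congr (by simp) (by simp)

/-- Triples are visited in the storage order of the array, so the address `(b * n₃ + c) * n₁ + a` is
maintained by increments alone. -/
theorem runs_emitPair {f : ℕ → ℕ} {n₁ n₃ b c : ℕ} (h5 : s.reg 5 = 1) (h6 : s.reg 6 = 0)
    (h0 : s.reg 0 = n₁) (h13 : s.reg 13 = b) (h15 : s.reg 15 = c) (hf : s.arr 7 = f)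
    (h20 : s.reg 20 = (b * n₃ + c) * n₁) :
    Runs emitPair s (n₁ * 12 + 6) fun s' => (∀ x < 15, x ≠ 4 → s'.reg x = s.reg x) ∧
      s'.arr 7 = f ∧ s'.reg 20 = (b * n₃ + (c + 1)) * n₁ ∧ s'.reg 15 = c + 1 ∧
      s'.reg 16 = s.reg 16 - 1 ∧
      s'.edgeList = s.edgeList ++ pairTriples f n₁ n₃ b c n₁ := by
  refine .const_cons (by omega) (.add_cons (.loop_cons
    (fun m t => t.reg 18 = m ∧ t.reg 18 + t.reg 17 = n₁ ∧
      (∀ x < 17, x ≠ 4 → t.reg x = s.reg x) ∧ t.arr 7 = f ∧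
      t.reg 20 = (b * n₃ + c) * n₁ + t.reg 17 ∧
      t.edgeList = s.edgeList ++ pairTriples f n₁ n₃ b c (t.reg 17))
    n₁ 11 3 (by omega) ?_ ?_ ?_))
  · refine ⟨?_, ?_, fun x hx hx4 => ?_, ?_, ?_, ?_⟩
    · simp [h0, h6]
    · simp [h0, h6]
    · simp (disch := omega)
    · simp [hf]
    · simp [h20]
    · simpa [pairTriples] using State.edgeList_congr (by simp) (by simp)
  · rintro m t ⟨rfl, hj, hlow, harr, hp, hl⟩ hne
    refine (runs_emitStep (by rw [hlow 5 (by omega) (by omega), h5])).mono le_rfl ?_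
    rintro u ⟨hlow', harr', h20', h17', h18', hl'⟩
    refine ⟨_, ?_, rfl, by omega, fun x hx hx4 => by rw [hlow' x hx hx4, hlow x hx hx4],
      harr'.trans harr, by omega, ?_⟩
    · omega
    · rw [hl', hl, h17', hlow 13 (by omega) (by omega), hlow 15 (by omega) (by omega), harr, hp,
        h13, h15, List.append_assoc]
      simp [pairTriples, List.range_succ]
  · rintro m t ⟨-, hj, hlow, harr, hp, hl⟩ h18
    have hn : t.reg 17 = n₁ := by omega
    rw [hn] at hl hp
    refine .add_cons (.sub_cons (.nil ⟨fun x hx hx4 => ?_, ?_, ?_, ?_, ?_, ?_⟩))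
    · simp (disch := omega)
      exact hlow x (by omega) hx4
    · simp [harr]
    · simp [hp]; ring
    · simp [hlow, h15, h5]
    · simp [hlow, h5]
    · rw [← hl]
      exact State.edgeList_congr (by simp) (by simp)

theorem runs_emitRow {f : ℕ → ℕ} {n₁ n₃ b : ℕ} (h5 : s.reg 5 = 1) (h6 : s.reg 6 = 0)
    (h0 : s.reg 0 = n₁) (h2 : s.reg 2 = n₃) (h13 : s.reg 13 = b) (hf : s.arr 7 = f)
    (h20 : s.reg 20 = b * n₃ * n₁) :
    Runs emitRow s (n₃ * (n₁ * 12 + 7) + 6) fun s' => (∀ x < 13, x ≠ 4 → s'.reg x = s.reg x) ∧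
      s'.arr 7 = f ∧ s'.reg 20 = (b + 1) * n₃ * n₁ ∧ s'.reg 13 = b + 1 ∧
      s'.reg 14 = s.reg 14 - 1 ∧ s'.edgeList = s.edgeList ++ rowTriples f n₁ n₃ b n₃ := by
  refine .const_cons (by omega) (.add_cons (.loop_cons
    (fun m t => t.reg 16 = m ∧ t.reg 16 + t.reg 15 = n₃ ∧
      (∀ x < 15, x ≠ 4 → t.reg x = s.reg x) ∧ t.arr 7 = f ∧
      t.reg 20 = (b * n₃ + t.reg 15) * n₁ ∧
      t.edgeList = s.edgeList ++ rowTriples f n₁ n₃ b (t.reg 15))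
    n₃ (n₁ * 12 + 6) 3 le_rfl ?_ ?_ ?_))
  · refine ⟨?_, ?_, fun x hx hx4 => ?_, ?_, ?_, ?_⟩
    · simp [h2, h6]
    · simp [h2, h6]
    · simp (disch := omega)
    · simp [hf]
    · simp [h20]
    · simpa [rowTriples] using State.edgeList_congr (by simp) (by simp)
  · rintro m t ⟨rfl, hj, hlow, harr, hp, hl⟩ hne
    refine (runs_emitPair (n₃ := n₃) (by rw [hlow 5 (by omega) (by omega), h5])
      (by rw [hlow 6 (by omega) (by omega), h6]) (by rw [hlow 0 (by omega) (by omega), h0])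
      (by rw [hlow 13 (by omega) (by omega), h13]) rfl harr hp).mono le_rfl ?_
    rintro u ⟨hlow', harr', h20', h15', h16', hl'⟩
    refine ⟨_, ?_, rfl, by omega, fun x hx hx4 => by rw [hlow' x hx hx4, hlow x hx hx4],
      harr', by rw [h20', h15'], ?_⟩
    · omega
    · rw [hl', hl, h15', List.append_assoc]
      simp [rowTriples, List.range_succ]
  · rintro m t ⟨-, hj, hlow, harr, hp, hl⟩ h16
    have hn : t.reg 15 = n₃ := by omega
    rw [hn] at hl hp
    refine .add_cons (.sub_cons (.nil ⟨fun x hx hx4 => ?_, ?_, ?_, ?_, ?_, ?_⟩))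
    · simp (disch := omega)
      exact hlow x (by omega) hx4
    · simp [harr]
    · simp only [ne_eq, Nat.reduceEqDiff, not_false_eq_true,
        State.reg_setReg_ne, hp]
      ring
    · simp [hlow, h13, h5]
    · simp [hlow, h5]
    · rw [← hl]
      exact State.edgeList_congr (by simp) (by simp)

/-- A bound for the number of steps that are needed to list the hyperedges. -/
def emitSteps (n₁ n₂ n₃ : ℕ) : ℕ := n₂ * (n₃ * (n₁ * 12 + 7) + 7) + 5

theorem runs_emit {f : ℕ → ℕ} {n₁ n₂ n₃ : ℕ} (h5 : s.reg 5 = 1) (h6 : s.reg 6 = 0)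
    (h0 : s.reg 0 = n₁) (h1 : s.reg 1 = n₂) (h2 : s.reg 2 = n₃) (hf : s.arr 7 = f)
    (h4 : s.reg 4 = 0) :
    Runs emit s (emitSteps n₁ n₂ n₃) fun s' => (∀ x < 13, x ≠ 4 → s'.reg x = s.reg x) ∧
      s'.edgeList = triples f n₁ n₃ n₂ := by
  refine .const_cons (by omega) (.const_cons (by omega) (.add_cons (.loop_cons
    (fun m t => t.reg 14 = m ∧ t.reg 14 + t.reg 13 = n₂ ∧
      (∀ x < 13, x ≠ 4 → t.reg x = s.reg x) ∧ t.arr 7 = f ∧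
      t.reg 20 = t.reg 13 * n₃ * n₁ ∧ t.edgeList = triples f n₁ n₃ (t.reg 13))
    n₂ (n₃ * (n₁ * 12 + 7) + 6) 1 le_rfl ?_ ?_ ?_)))
  · refine ⟨?_, ?_, fun x hx hx4 => ?_, ?_, ?_, ?_⟩
    · simp [h1, h6]
    · simp [h1, h6]
    · simp (disch := omega)
    · simp [hf]
    · simp
    · simp [triples, State.edgeList, h4]
  · rintro m t ⟨rfl, hj, hlow, harr, hp, hl⟩ hne
    refine (runs_emitRow (by rw [hlow 5 (by omega) (by omega), h5])
      (by rw [hlow 6 (by omega) (by omega), h6]) (by rw [hlow 0 (by omega) (by omega), h0])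
      (by rw [hlow 2 (by omega) (by omega), h2]) rfl harr hp).mono le_rfl ?_
    rintro u ⟨hlow', harr', h20', h13', h14', hl'⟩
    refine ⟨_, ?_, rfl, by omega, fun x hx hx4 => by rw [hlow' x hx hx4, hlow x hx hx4],
      harr', by rw [h20', h13'], ?_⟩
    · omega
    · rw [hl', hl, h13']
      simp [triples, List.range_succ]
  · rintro m t ⟨-, hj, hlow, harr, hp, hl⟩ h14
    rw [show t.reg 13 = n₂ by omega] at hl
    exact .nil ⟨hlow, hl⟩

end RAM

/-! ## Hypergraphs as matrices -/

namespace PartiteHypergraph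

variable {n₁ n₂ n₃ : ℕ}

open Classical in
/-- The indicator function of the set of hyperedges, on triples of natural numbers. -/
noncomputable def indicator (H : PartiteHypergraph n₁ n₂ n₃) (a b c : ℕ) : ℕ :=
  if ∃ (ha : a < n₁) (hb : b < n₂) (hc : c < n₃),
    ((⟨a, ha⟩, ⟨b, hb⟩, ⟨c, hc⟩) : Fin n₁ × Fin n₂ × Fin n₃) ∈ H then 1 else 0

theorem indicator_le_one (H : PartiteHypergraph n₁ n₂ n₃) (a b c : ℕ) : H.indicator a b c ≤ 1 := by
  unfold indicator; split_ifs <;> omega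

theorem indicator_coe (H : PartiteHypergraph n₁ n₂ n₃) (a : Fin n₁) (b : Fin n₂) (c : Fin n₃) :
    H.indicator a b c = if (a, b, c) ∈ H then 1 else 0 := by
  simp [indicator]

theorem card_filter_eq_sum_indicator (H : PartiteHypergraph n₁ n₂ n₃)
    (p : Fin n₁ × Fin n₂ × Fin n₃ → Prop) [DecidablePred p] :
    (H.filter p).card = ∑ a : Fin n₁, ∑ b : Fin n₂, ∑ c : Fin n₃,
      if p (a, b, c) then H.indicator a b c else 0 := by
  have : H.filter p = univ.filter fun e => p e ∧ e ∈ H := by ext; simp [and_comm]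
  rw [this, card_filter, Fintype.sum_prod_type]
  simp only [Fintype.sum_prod_type, indicator_coe, ite_and]

theorem degA_eq (H : PartiteHypergraph n₁ n₂ n₃) (a : Fin n₁) :
    H.degA a = ∑ b ∈ range n₂, ∑ c ∈ range n₃, H.indicator a b c := by
  simp only [degA, card_filter_eq_sum_indicator, sum_range]
  rw [sum_eq_single a (fun x _ hx => by simp [hx]) (by simp)]
  simp

theorem degB_eq (H : PartiteHypergraph n₁ n₂ n₃) (b : Fin n₂) :
    H.degB b = ∑ c ∈ range n₃, ∑ a ∈ range n₁, H.indicator a b c := by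
  simp only [degB, card_filter_eq_sum_indicator, sum_range]
  rw [sum_comm, sum_eq_single b (fun x _ hx => by simp [hx]) (by simp), sum_comm]
  simp

theorem degC_eq (H : PartiteHypergraph n₁ n₂ n₃) (c : Fin n₃) :
    H.degC c = ∑ b ∈ range n₂, ∑ a ∈ range n₁, H.indicator a b c := by
  simp only [degC, card_filter_eq_sum_indicator, sum_range]
  rw [sum_comm]
  exact sum_congr rfl fun b _ => sum_congr rfl fun a _ => by simp

end PartiteHypergraph

theorem sum_range_mul {M : Type*} [AddCommMonoid M] (f : ℕ → M) (R C : ℕ) :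
    ∑ p ∈ range (R * C), f p = ∑ x ∈ range R, ∑ y ∈ range C, f (x * C + y) := by
  induction R with
  | zero => simp
  | succ R ih => rw [add_mul, one_mul, sum_range_add, ih, sum_range_succ]

variable {n₁ n₂ n₃ : ℕ}

/-- A sequence on `Fin n`, extended by zero. -/
def extendZero {n : ℕ} (d : Fin n → ℕ) (i : ℕ) : ℕ := if h : i < n then d ⟨i, h⟩ else 0

@[simp] theorem extendZero_coe {n : ℕ} (d : Fin n → ℕ) (i : Fin n) : extendZero d i = d i := by
  simp [extendZero]

theorem extendZero_of_lt {n : ℕ} (d : Fin n → ℕ) {i : ℕ} (h : i < n) :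
    extendZero d i = d ⟨i, h⟩ := dif_pos h

namespace PartiteHypergraph.IsRealization

variable {H : PartiteHypergraph n₁ n₂ n₃} {D : DegreeSequence n₁ n₂ n₃}

/-- Counting the hyperedges over each pair `(b, c)` projects a realization to a solution of the
first matrix problem. -/
theorem isTransport (h : H.IsRealization D) :
    IsTransport n₂ n₃ n₁ (extendZero D.dB) (extendZero D.dC)
      fun b c => ∑ a ∈ range n₁, H.indicator a b c := by
  refine ⟨fun b _ c _ => ?_, fun b hb => ?_, fun c hc => ?_⟩
  · simpa using sum_le_card_nsmul (range n₁) (fun a => H.indicator a b c) 1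
      fun a _ => H.indicator_le_one a b c
  · rw [extendZero_of_lt _ hb, ← h.2.1, degB_eq]
  · rw [extendZero_of_lt _ hc, ← h.2.2, degC_eq]

theorem sum_dB_eq (h : H.IsRealization D) :
    ∑ b ∈ range n₂, extendZero D.dB b = ∑ a ∈ range n₁, extendZero D.dA a := by
  have hB : ∀ b ∈ range n₂, extendZero D.dB b
      = ∑ a ∈ range n₁, ∑ c ∈ range n₃, H.indicator a b c := fun b hb => by
    rw [extendZero_of_lt _ (mem_range.1 hb), ← h.2.1, degB_eq, sum_comm]
  have hA : ∀ a ∈ range n₁, extendZero D.dA a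
      = ∑ b ∈ range n₂, ∑ c ∈ range n₃, H.indicator a b c := fun a ha => by
    rw [extendZero_of_lt _ (mem_range.1 ha), ← h.1, degA_eq]
  rw [sum_congr rfl hB, sum_congr rfl hA, sum_comm]

end PartiteHypergraph.IsRealization

/-- For a third almost-regular sequence, each transport matrix for the second and third classes can
be spread over the first class. -/
theorem DegreeSequence.Graphic.exists_isTransport {D : DegreeSequence n₁ n₂ n₃} (hD : D.Graphic)
    (hreg : D.ThirdAlmostRegular) {m : ℕ → ℕ}
    (hm : IsTransport n₂ n₃ n₁ (extendZero D.dB) (extendZero D.dC) fun b c => m (b * n₃ + c)) :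
    ∃ M, IsTransport (n₂ * n₃) n₁ 1 m (extendZero D.dA) M := by
  obtain ⟨k, hk⟩ := hreg
  obtain ⟨H, hH⟩ := hD
  refine exists_isTransport_of_almostRegular (k := k) (fun p hp => ?_) (fun j hj => ?_) ?_
  · have h3 : 0 < n₃ := Nat.pos_of_ne_zero (by rintro rfl; simp at hp)
    have := hm.le (p / n₃) (Nat.div_lt_of_lt_mul (by rwa [mul_comm])) (p % n₃) (Nat.mod_lt _ h3)
    rwa [Nat.div_add_mod'] at this
  · rw [extendZero_of_lt _ hj]; exact hk _
  -- Graphicness enters only here: it makes the totals of `dA` and `dB`, hence of `dA` and `m`,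
  -- agree.
  · rw [sum_range_mul, ← hH.sum_dB_eq]
    exact sum_congr rfl fun b hb => hm.row_sum b (mem_range.1 hb)

/-- The hypergraph with the hyperedges `(a, b, c)` for which `f ((b * n₃ + c) * n₁ + a) ≠ 0`. -/
def PartiteHypergraph.ofArray (n₁ n₂ n₃ : ℕ) (f : ℕ → ℕ) : PartiteHypergraph n₁ n₂ n₃ :=
  univ.filter fun e => f ((e.2.1 * n₃ + e.2.2) * n₁ + e.1) ≠ 0

theorem PartiteHypergraph.isRealization_ofArray {D : DegreeSequence n₁ n₂ n₃} {m f : ℕ → ℕ}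
    (hm : IsTransport n₂ n₃ n₁ (extendZero D.dB) (extendZero D.dC) fun b c => m (b * n₃ + c))
    (hf : IsTransport (n₂ * n₃) n₁ 1 m (extendZero D.dA) fun p a => f (p * n₁ + a)) :
    (PartiteHypergraph.ofArray n₁ n₂ n₃ f).IsRealization D := by
  have hlt : ∀ b < n₂, ∀ c < n₃, b * n₃ + c < n₂ * n₃ := fun b hb c hc => by
    have := Nat.mul_le_mul_right n₃ (show b + 1 ≤ n₂ from hb)
    rw [add_mul] at this
    omega
  have hind : ∀ a < n₁, ∀ b < n₂, ∀ c < n₃,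
      (PartiteHypergraph.ofArray n₁ n₂ n₃ f).indicator a b c = f ((b * n₃ + c) * n₁ + a) :=
    fun a ha b hb c hc => by
      have := indicator_coe (ofArray n₁ n₂ n₃ f) ⟨a, ha⟩ ⟨b, hb⟩ ⟨c, hc⟩
      have hle := hf.le _ (hlt b hb c hc) a ha
      simp only [ofArray, mem_filter, mem_univ, true_and] at this
      rw [ofArray, this]
      -- Entries of `f` are at most one, so being nonzero and being one are the same.
      split_ifs <;> omega
  have hrow : ∀ b < n₂, ∀ c < n₃, ∑ a ∈ range n₁,
      (PartiteHypergraph.ofArray n₁ n₂ n₃ f).indicator a b c = m (b * n₃ + c) :=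
    fun b hb c hc => by
      rw [← hf.row_sum _ (hlt b hb c hc)]
      exact sum_congr rfl fun a ha => hind a (mem_range.1 ha) b hb c hc
  refine ⟨fun a => ?_, fun b => ?_, fun c => ?_⟩
  · rw [degA_eq, ← extendZero_coe D.dA, ← hf.col_sum a a.2, sum_range_mul]
    exact sum_congr rfl fun b hb => sum_congr rfl fun c hc =>
      hind a a.2 b (mem_range.1 hb) c (mem_range.1 hc)
  · rw [degB_eq, ← extendZero_coe D.dB, ← hm.row_sum b b.2]
    exact sum_congr rfl fun c hc => hrow b b.2 c (mem_range.1 hc)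
  · rw [degC_eq, ← extendZero_coe D.dC, ← hm.col_sum c c.2]
    exact sum_congr rfl fun b hb => hrow b (mem_range.1 hb) c c.2

namespace RAM

theorem State.outputs_ofArray {s : State} {f : ℕ → ℕ} (h : s.edgeList = triples f n₁ n₃ n₂) :
    s.Outputs (PartiteHypergraph.ofArray n₁ n₂ n₃ f) := by
  refine ⟨h ▸ nodup_triples f n₁ n₃ n₂, fun x y z => ?_⟩
  rw [h, mem_triples]
  simp only [PartiteHypergraph.ofArray, mem_filter, mem_univ, true_and, exists_prop]

/-! ## The whole algorithm -/

/-- Distribute the degrees of the second and third classes over the pairs of their vertices, spread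
the pairs over the first class and list the hyperedges. -/
def realize : Prog := block
  [.const 5 1, .add 8 1 6, .add 9 2 6, .add 10 0 6, greedy 1 2 6,
   .add 8 12 6, .add 9 0 6, .const 10 1, greedy 6 0 7, emit, .sub 3 5 11]

/-- A bound for the number of steps of the algorithm. -/
def realizeSteps (n₁ n₂ n₃ : ℕ) : ℕ :=
  greedySteps n₂ n₃ n₁ + greedySteps (n₂ * n₃) n₁ 1 + emitSteps n₁ n₂ n₃ + 9

theorem runs_realize (D : DegreeSequence n₁ n₂ n₃) (hreg : D.ThirdAlmostRegular) :
    Runs realize (input D) (realizeSteps n₁ n₂ n₃) fun s =>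
      (D.Graphic → s.Accepts ∧
        ∃ H : PartiteHypergraph n₁ n₂ n₃, H.IsRealization D ∧ s.Outputs H) ∧
      (¬ D.Graphic → s.Rejects) := by
  have hin : ∀ x, (input D).reg x = if x = 0 then n₁ else if x = 1 then n₂ else
    if x = 2 then n₃ else 0 := fun x => rfl
  have hA : (input D).arr 0 = extendZero D.dA := rfl
  have hB : (input D).arr 1 = extendZero D.dB := rfl
  have hC : (input D).arr 2 = extendZero D.dC := rfl
  have hz : ∀ a, 3 ≤ a → (input D).arr a = fun _ => 0 := fun a ha => by
    funext i
    simp [input, show a ≠ 0 by omega, show a ≠ 1 by omega, show a ≠ 2 by omega]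
  refine .of_le (K := (emitSteps n₁ n₂ n₃ + greedySteps (n₂ * n₃) n₁ 1 + 5)
    + greedySteps n₂ n₃ n₁ + 4) (by unfold realizeSteps; omega)
    (.const_cons le_rfl (.add_cons (.add_cons (.add_cons ?_))))
  generalize hs : ((((input D).setReg 5 1).setReg 8 _).setReg 9 _).setReg 10 _ = s
  have e0 : s.reg 0 = n₁ := by simp [← hs, hin]
  have e1 : s.reg 1 = n₂ := by simp [← hs, hin]
  have e2 : s.reg 2 = n₃ := by simp [← hs, hin]
  have e4 : s.reg 4 = 0 := by simp [← hs, hin]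
  have e5 : s.reg 5 = 1 := by simp [← hs]
  have e6 : s.reg 6 = 0 := by simp [← hs, hin]
  have e8 : s.reg 8 = n₂ := by simp [← hs, hin]
  have e9 : s.reg 9 = n₃ := by simp [← hs, hin]
  have e10 : s.reg 10 = n₁ := by simp [← hs, hin]
  have e11 : s.reg 11 = 0 := by simp [← hs, hin]
  have earr : s.arr = (input D).arr := by simp [← hs]
  clear hs
  have hgreedy := runs_greedy (r := 1) (c := 2) (o := 6) (by simp) (by simp) (by simp) e5 e6
    (by rw [earr, hz 6 (by omega)])
  rw [e8, e9, e10, e11, earr, hB, hC] at hgreedy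
  refine .cons (hgreedy.mono le_rfl ?_)
  rintro s₁ ⟨hlow₁, harr₁, h12₁, hsol₁, hex₁⟩
  refine .add_cons (.add_cons (.const_cons le_rfl ?_))
  generalize ht : ((s₁.setReg 8 _).setReg 9 _).setReg 10 1 = t
  have f0 : t.reg 0 = n₁ := by simp [← ht, hlow₁, e0]
  have f1 : t.reg 1 = n₂ := by simp [← ht, hlow₁, e1]
  have f2 : t.reg 2 = n₃ := by simp [← ht, hlow₁, e2]
  have f4 : t.reg 4 = 0 := by simp [← ht, hlow₁, e4]
  have f5 : t.reg 5 = 1 := by simp [← ht, hlow₁, e5]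
  have f6 : t.reg 6 = 0 := by simp [← ht, hlow₁, e6]
  have f8 : t.reg 8 = n₂ * n₃ := by simp [← ht, hlow₁, h12₁, e6]
  have f9 : t.reg 9 = n₁ := by simp [← ht, hlow₁, e6, e0]
  have f10 : t.reg 10 = 1 := by simp [← ht]
  have f11 : t.reg 11 = s₁.reg 11 := by simp [← ht]
  have farr : t.arr = s₁.arr := by simp [← ht]
  clear ht
  have hgreedy := runs_greedy (r := 6) (c := 0) (o := 7) (by simp) (by simp) (by simp) f5 f6
    (by rw [farr, harr₁ 7 (by simp) (by simp), hz 7 (by omega)])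
  rw [f8, f9, f10, f11, farr, harr₁ 0 (by simp) (by simp), hA] at hgreedy
  refine .of_le (K := emitSteps n₁ n₂ n₃ + 2 + greedySteps (n₂ * n₃) n₁ 1) (by omega)
    (.cons (hgreedy.mono le_rfl ?_))
  rintro s₂ ⟨hlow₂, harr₂, -, hsol₂, hex₂⟩
  refine .of_le (K := 2 + emitSteps n₁ n₂ n₃) (by omega) (.cons ((runs_emit (f := s₂.arr 7)
    (by rw [hlow₂ 5 (by omega), f5]) (by rw [hlow₂ 6 (by omega), f6])
    (by rw [hlow₂ 0 (by omega), f0]) (by rw [hlow₂ 1 (by omega), f1])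
    (by rw [hlow₂ 2 (by omega), f2]) rfl (by rw [hlow₂ 4 (by omega), f4])).mono le_rfl ?_))
  rintro s₃ ⟨hlow₃, hlist⟩
  refine .sub_cons (.nil ?_)
  have h3 : (s₃.setReg 3 (s₃.reg 5 - s₃.reg 11)).reg 3 = 1 - s₂.reg 11 := by
    rw [State.reg_setReg_same, hlow₃ 5 (by omega) (by omega), hlow₃ 11 (by omega) (by omega),
      hlow₂ 5 (by omega), f5]
  -- The second run inherits the flag of the first, so a zero at the end certifies both. After a
  -- failure the remaining stages still run, harmlessly, within their step bounds.
  have hsound : s₂.reg 11 = 0 →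
      (PartiteHypergraph.ofArray n₁ n₂ n₃ (s₂.arr 7)).IsRealization D := fun h => by
    obtain ⟨h', hf⟩ := hsol₂ h
    exact PartiteHypergraph.isRealization_ofArray (hsol₁ h').2 hf
  refine ⟨fun hD => ?_, fun hD => ?_⟩
  · obtain ⟨H, hH⟩ := id hD
    have h₁ := hex₁ rfl ⟨_, hH.isTransport⟩
    -- The matrix found first need not come from `H`; almost-regularity makes the second problem
    -- solvable all the same.
    have h₂ := hex₂ h₁ (hD.exists_isTransport hreg (hsol₁ h₁).2)
    refine ⟨by rw [State.Accepts, h3, h₂], _, hsound h₂, State.outputs_ofArray ?_⟩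
    rw [← hlist]
    simp [State.edgeList]
  · rw [State.Rejects, h3]
    have : s₂.reg 11 ≠ 0 := fun h => hD ⟨_, hsound h⟩
    omega

/-! ### From step counts to a polynomial in the input length -/

theorem length_le_bitLength (D : DegreeSequence n₁ n₂ n₃) :
    n₁ ≤ D.bitLength ∧ n₂ ≤ D.bitLength ∧ n₃ ≤ D.bitLength := by
  -- The separator of each entry contributes one, so the class sizes are bounded even if all degrees
  -- vanish.
  simp only [DegreeSequence.bitLength, sum_add_distrib, sum_const, card_univ, Fintype.card_fin,
    smul_eq_mul, mul_one]
  omega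

theorem sizeLE_input (D : DegreeSequence n₁ n₂ n₃) : (input D).SizeLE D.bitLength := by
  have hn : ∀ n, Nat.size n ≤ n := fun n => Nat.size_le.2 Nat.lt_two_pow_self
  obtain ⟨h1, h2, h3⟩ := length_le_bitLength D
  have hmem : ∀ {n} (d : Fin n → ℕ) (i : Fin n), Nat.size (d i) ≤ ∑ i, (Nat.size (d i) + 1) :=
    fun d i => (Nat.le_succ _).trans
      (single_le_sum (f := fun i => Nat.size (d i) + 1) (fun _ _ => Nat.zero_le _) (mem_univ i))
  refine ⟨fun x => ?_, fun a i => ?_⟩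
  · refine (hn _).trans ?_
    simp only [input]
    split_ifs <;> omega
  · simp only [input, DegreeSequence.bitLength]
    split_ifs with _ h _ h _ h
    · have := hmem D.dA ⟨i, h⟩; omega
    · simp
    · have := hmem D.dB ⟨i, h⟩; omega
    · simp
    · have := hmem D.dC ⟨i, h⟩; omega
    · simp
    · simp

theorem realizeSteps_mono {N : ℕ} (h1 : n₁ ≤ N) (h2 : n₂ ≤ N) (h3 : n₃ ≤ N) :
    realizeSteps n₁ n₂ n₃ ≤ realizeSteps N N N := by
  unfold realizeSteps greedySteps rowSteps emitSteps
  gcongr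

open Polynomial in
theorem exists_polynomial_eval_eq_realizeSteps :
    ∃ p : ℕ[X], ∀ N, p.eval N = realizeSteps N N N := by
  refine ⟨(X * ((X * X + 1) * (21 * X + 17) + 6 + 1) + 8 * X + 10)
    + (X * X * ((X * 1 + 1) * (21 * X + 17) + 6 + 1) + 8 * X + 10)
    + (X * (X * (X * 12 + 7) + 7) + 5) + 9, fun N => ?_⟩
  simp [realizeSteps, greedySteps, rowSteps, emitSteps]

end RAM

theorem mainTheorem2 :
    ∃ (P : RAM.Prog) (p : Polynomial ℕ),
      ∀ (n₁ n₂ n₃ : ℕ) (D : DegreeSequence n₁ n₂ n₃), D.ThirdAlmostRegular →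
        ∃ (t : ℕ) (s : RAM.State),
          RAM.Exec P (RAM.input D) t s ∧ t ≤ p.eval D.bitLength ∧
          (D.Graphic → s.Accepts ∧
            ∃ H : PartiteHypergraph n₁ n₂ n₃, H.IsRealization D ∧ s.Outputs H) ∧
          (¬ D.Graphic → s.Rejects) := by
  obtain ⟨p, hp⟩ := RAM.exists_polynomial_eval_eq_realizeSteps
  -- The bound in `Runs` with `w = N` digits and `K = p(N)` steps.
  refine ⟨RAM.realize, p * (2 * (Polynomial.X + p) + 1), fun n₁ n₂ n₃ D hreg => ?_⟩
  obtain ⟨h1, h2, h3⟩ := RAM.length_le_bitLength D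
  obtain ⟨t, s, hexec, ht, -, hs⟩ :=
    (RAM.runs_realize D hreg).of_le (RAM.realizeSteps_mono h1 h2 h3) _ (RAM.sizeLE_input D)
  exact ⟨t, s, hexec, by simpa [hp] using ht, hs⟩
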